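/- **Setting.** Let $d\ge 2$, $N\ge 1$, let $\Omega\subset\mathbb R^d$ be a bounded, connected, open Lipschitz set with $\partial\Omega=\overline{\Gamma_N}\cup\overline{\Gamma_D}$, where $\Gamma_N,\Gamma_D$ are disjoint and relatively open in $\partial\Omega$ and $\Gamma_D=\Gamma_D^1\cup\Gamma_D^2$ consists of two connected, separated pieces of positive surface measure. Let $\Gamma\subset\Omega$ be a connected interface with $\Omega\setminus\Gamma=\Omega_1\cup\Omega_2$, where $\Omega_1,\Omega_2$ are disjoint, connected, open Lipschitz sets, $\Gamma\subset\partial\Omega_1\cap\partial\Omega_2$ and $\Gamma_D^i\subset\partial\Omega_i$. The unit normal $n$ on $\Gamma$ points outwards from $\Omega_1$; $\Gamma$ carries the $(d-1)$-dimensional surface measure. For $q\in L^1(\Omega;\mathbb R^N)$, $\nabla q$ denotes the weak gradient in $\Omega\setminus\Gamma$ (assumed in $L^1$), and $[q]=\mathrm{tr}_{\Omega_2}q|_\Gamma-\mathrm{tr}_{\Omega_1}q|_\Gamma$. For $\tau\in L^1(\Omega;\mathbb R^{d\times N})$, $\tau\cdot n=w\in L^1(\Gamma;\mathbb R^N)$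 means $\int_\Gamma w\cdot\varphi=\int_{\Omega_1}\nabla\varphi:\tau$ for all compactly supported Lipschitz $\varphi:\Omega\to\mathbb R^N$. An N-function is a Carathéodory function $\Upsilon(x,z)\ge0$ that for a.e. $x$ is even and convex in $z$, with $\Upsilon(x,z)/|z|\to0$ as $|z|\to0$ and $\Upsilon(x,z)/|z|\to\infty$ as $|z|\to\infty$; $\Upsilon^*(x,z)=\sup_y(z\cdot y-\Upsilon(x,y))$. $L^\Upsilon$ is the linear hull of $\{v\in L^1:\int\Upsilon(x,v)<\infty\}$ with the Luxemburg norm, and $E^\Upsilon$ is the closure of $L^\infty$ in it. $\Upsilon$ satisfies $\Delta_2$ if there are $c,K>0$ with $\Upsilon(x,2z)\le c\,\Upsilon(x,z)$ for a.e. $x$ and all $|z|>K$. Let $\Phi$ (on $\Omega\times\mathbb R^{d\times N}$) and $\Psi$ (on $\Gamma\times\mathbb R^N$) be N-functions such that $\Phi(\cdot,v),\Phi^*(\cdot,v)\in L^1(\Omega)$ and $\Psi(\cdot,z),\Psi^*(\cdot,z)\in L^1(\Gamma)$ for all fixed $v,z$. Condition $(\Delta)$: both $\Phi,\Psi$ satisfy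 $\Delta_2$, or both $\Phi^*,\Psi^*$ do. Spaces: - $P$ is the set of $q\in L^1(\Omega;\mathbb R^N)$ with $\nabla q\in L^\Phi(\Omega)$, $[q]\in L^\Psi(\Gamma)$ and zero traces from $\Omega_1$ and $\Omega_2$ on $\Gamma_D$; $EP=\{q\in P:\nabla q\in E^\Phi(\Omega),[q]\in E^\Psi(\Gamma)\}$; $BP$ is the set of $q\in P$ for which there are $q^n\in EP$ with $\nabla q^n\rightharpoonup^*\nabla q$ in $L^\Phi(\Omega)=(E^{\Phi^*}(\Omega))^*$ and $[q^n]\rightharpoonup^*[q]$ in $L^\Psi(\Gamma)=(E^{\Psi^*}(\Gamma))^*$. - $X$ is the set of $\tau\in L^{\Phi^*}(\Omega)$ with $\tau\cdot n\in L^{\Psi^*}(\Gamma)$ and $\int_\Gamma(\tau\cdot n)\cdot[q]+\int_\Omega\nabla q:\tau=0$ for all $q\in EP$; $EX=\{\tau\in X:\tau\in E^{\Phi^*}(\Omega),\tau\cdot n\in E^{\Psi^*}(\Gamma)\}$; $BX$ is the set of $\tau\in X$ for which there are $\tau^n\in EX$ with $\tau^n\rightharpoonup^*\tau$ in $L^{\Phi^*}(\Omega)=(E^{\Phi}(\Omega))^*$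 and $\tau^n\cdot n\rightharpoonup^*\tau\cdot n$ in $L^{\Psi^*}(\Gamma)=(E^{\Psi}(\Gamma))^*$. Data: $\phi_0\in W^{1,1}(\Omega;\mathbb R^N)$ with $\nabla\phi_0\in E^\Phi(\Omega)$; $j_0\in E^{\Phi^*}(\Omega)$ with $j_0\cdot n=0$ on $\Gamma$ and $\mathrm{Div}\,j_0=0$ in $\Omega$. Nonlinearities: $h,f:\Omega\times\mathbb R^{d\times N}\to\mathbb R^{d\times N}$ and $b,g:\Gamma\times\mathbb R^N\to\mathbb R^N$ are Carathéodory, monotone in the second variable and zero at zero, and for some $C\ge0$ and constants $\alpha_h,\alpha_b,\alpha_f,\alpha_g\in(0,1]$, for a.e. $x$ and all $v,z$, $$h(v):v\ge\alpha_h(\Phi^*(h(v))+\Phi(v))-C,\qquad b(z)\cdot z\ge\alpha_b(\Psi^*(b(z))+\Psi(z))-C,$$ $$f(v):v\ge\alpha_f(\Phi^*(v)+\Phi(f(v)))-C,\qquad g(z)\cdot z\ge\alpha_g(\Psi^*(z)+\Psi(g(z)))-C$$ (the dependence on $x$ is not written). Solutions: - $\phi$ with $\phi-\phi_0\in P$ is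 a *variational weak solution* if for all $q\in EP$ $$\int_\Omega(h(\nabla\phi)-j_0):\nabla(\phi-\phi_0-q)+\int_\Gamma b([\phi])\cdot[\phi-q]\le0$$ (integrals with values in $(-\infty,\infty]$). It is a *weak solution* if $h(\nabla\phi)\in L^{\Phi^*}(\Omega)$, $b([\phi])\in L^{\Psi^*}(\Gamma)$ and $\int_\Omega h(\nabla\phi):\nabla q+\int_\Gamma b([\phi])\cdot[q]=\int_\Omega j_0:\nabla q$ for all $q\in EP$. - $j$ with $j-j_0\in X$ is a *variational weak solution of the flux problem* if for all $\tau\in EX$ $$\int_\Omega(f(j)-\nabla\phi_0):(j-j_0-\tau)+\int_\Gamma g(j\cdot n)\cdot((j-\tau)\cdot n)\le0.$$ It is a *weak solution of the flux problem* if $f(j)\in L^\Phi(\Omega)$, $g(j\cdot n)\in L^\Psi(\Gamma)$ and $\int_\Omega f(j):\tau+\int_\Gamma g(j\cdot n)\cdot(\tau\cdot n)=\int_\Omega\nabla\phi_0:\tau$ for all $\tau\in EX$. **Theorem.** 1. Every variational weak solution $\phi\in\phi_0+P$ is a weak solution, and $$\int_\Omega\big(\Phi(\nabla\phi)+\Phi^*(h(\nabla\phi))\big)+\int_\Gamma\big(\Psi([\phi])+\Psi^*(b([\phi]))\big)<\infty.$$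 2. If $(\Delta)$ holds, every weak solution $\phi\in\phi_0+BP$ is a variational weak solution. 3. Every variational weak solution $j\in j_0+X$ of the flux problem is a weak solution of the flux problem, and $$\int_\Omega\big(\Phi(f(j))+\Phi^*(j)\big)+\int_\Gamma\big(\Psi(g(j\cdot n))+\Psi^*(j\cdot n)\big)<\infty.$$ 4. If $(\Delta)$ holds, every weak solution $j\in j_0+BX$ of the flux problem is a variational weak solution of the flux problem. -/

import Mathlib

open MeasureTheory Filter Topology Set
open scoped NNReal ContDiff

noncomputable section

namespace InterfaceProblem

/-! ### N-functions and Musielak–Orlicz spaces over a measure space -/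

section Orlicz

variable {X V : Type*} [MeasurableSpace X] [NormedAddCommGroup V] [InnerProductSpace ℝ V]
  [MeasurableSpace V]

/-- Carathéodory mappings: continuous in the second variable for almost every `x`, measurable in
`x` for every fixed second variable. -/
structure IsCaratheodory {W : Type*} [TopologicalSpace W] [MeasurableSpace W] (μ : Measure X)
    (a : X → V → W) : Prop where
  continuous : ∀ᵐ x ∂μ, Continuous (a x)
  measurable : ∀ z, AEMeasurable (fun x => a x z) μ

/-- `Υ` is an N-function over the measure space `(X, μ)`. -/
structure IsNFunction (μ : Measure X) (Υ : X → V → ℝ) : Prop where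
  caratheodory : IsCaratheodory μ Υ
  nonneg : ∀ᵐ x ∂μ, ∀ z, 0 ≤ Υ x z
  even : ∀ᵐ x ∂μ, ∀ z, Υ x (-z) = Υ x z
  convex : ∀ᵐ x ∂μ, ConvexOn ℝ univ (Υ x)
  tendsto_zero : ∀ᵐ x ∂μ, Tendsto (fun z => Υ x z / ‖z‖) (𝓝[≠] 0) (𝓝 0)
  tendsto_infty : ∀ᵐ x ∂μ, Tendsto (fun z => Υ x z / ‖z‖) (Bornology.cobounded V) atTop

/-- The complementary function `Υ*(x, z) = sup_y (z · y - Υ(x, y))`. For an N-function the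
supremum is finite for almost every `x`. -/
def conj (Υ : X → V → ℝ) (x : X) (z : V) : ℝ := ⨆ y : V, (inner ℝ z y - Υ x y)

/-- All sections `Υ(·, z)` are integrable, i.e. `∫ Υ(x, v(x)) dμ < ∞` for all constant `v`. -/
def HasIntegrableSections (μ : Measure X) (Υ : X → V → ℝ) : Prop :=
  ∀ z, Integrable (fun x => Υ x z) μ

/-- The `Δ₂` condition. -/
def Delta2 (μ : Measure X) (Υ : X → V → ℝ) : Prop :=
  ∃ c K : ℝ, 0 < c ∧ 0 < K ∧ ∀ᵐ x ∂μ, ∀ z, K < ‖z‖ → Υ x ((2 : ℝ) • z) ≤ c * Υ x z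

/-- The set `M^Υ` of integrable `v` with `∫ Υ(x, v(x)) dμ < ∞`. -/
def orliczM (μ : Measure X) (Υ : X → V → ℝ) : Set (X → V) :=
  {v | Integrable v μ ∧ ∫⁻ x, ENNReal.ofReal (Υ x (v x)) ∂μ < ⊤}

/-- The Orlicz space `L^Υ`: the linear hull of `M^Υ`. -/
def orliczL (μ : Measure X) (Υ : X → V → ℝ) : Submodule ℝ (X → V) :=
  Submodule.span ℝ (orliczM μ Υ)

/-- The Luxemburg norm. -/
def luxNorm (μ : Measure X) (Υ : X → V → ℝ) (v : X → V) : ℝ :=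
  sInf {l : ℝ | 0 < l ∧ ∫⁻ x, ENNReal.ofReal (Υ x (l⁻¹ • v x)) ∂μ ≤ 1}

/-- The space `E^Υ`: the closure of `L^∞` in `L^Υ` with respect to the Luxemburg norm. -/
def orliczE (μ : Measure X) (Υ : X → V → ℝ) : Set (X → V) :=
  {v | v ∈ orliczL μ Υ ∧ ∀ ε : ℝ, 0 < ε →
    ∃ u : X → V, MemLp u ⊤ μ ∧ u ∈ orliczL μ Υ ∧ luxNorm μ Υ (v - u) < ε}

/-- The Lebesgue integral as an extended real number, `∫ f⁺ - ∫ f⁻`. It is used below for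
integrands whose negative part has finite integral (a consequence of coercivity and of the Young
inequality), so that its value there lies in `(-∞, ∞]`. -/
def extIntegral (μ : Measure X) (f : X → ℝ) : EReal :=
  ((∫⁻ x, ENNReal.ofReal (f x) ∂μ : ENNReal) : EReal) -
    ((∫⁻ x, ENNReal.ofReal (-f x) ∂μ : ENNReal) : EReal)

/-- A Carathéodory mapping, monotone and vanishing at zero. -/
structure IsMonotoneMap (μ : Measure X) (a : X → V → V) : Prop where
  caratheodory : IsCaratheodory μ a
  monotone : ∀ᵐ x ∂μ, ∀ v₁ v₂, 0 ≤ inner ℝ (a x v₁ - a x v₂) (v₁ - v₂)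
  zero : ∀ᵐ x ∂μ, a x 0 = 0

/-- `a(x,v) · v ≥ α (Υ*(x, a(x,v)) + Υ(x,v)) - C`. -/
def IsCoercive (μ : Measure X) (Υ : X → V → ℝ) (a : X → V → V) : Prop :=
  ∃ C α : ℝ, 0 ≤ C ∧ 0 < α ∧ α ≤ 1 ∧ ∀ᵐ x ∂μ, ∀ v,
    α * (conj Υ x (a x v) + Υ x v) - C ≤ inner ℝ (a x v) v

/-- `a(x,v) · v ≥ α (Υ*(x,v) + Υ(x, a(x,v))) - C`. -/
def IsDualCoercive (μ : Measure X) (Υ : X → V → ℝ) (a : X → V → V) : Prop :=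
  ∃ C α : ℝ, 0 ≤ C ∧ 0 < α ∧ α ≤ 1 ∧ ∀ᵐ x ∂μ, ∀ v,
    α * (conj Υ x v + Υ x (a x v)) - C ≤ inner ℝ (a x v) v

end Orlicz

/-! ### Weak gradients, traces and domains -/

/-- Points of `ℝ^d` and values in `ℝ^N`. -/
abbrev Vec (n : ℕ) : Type := EuclideanSpace ℝ (Fin n)

/-- `ℝ^{d×N}` with the scalar product `A : B`; the entry `(k, i)` of `∇q` is `∂q_i/∂x_k`. -/
abbrev Mat (d N : ℕ) : Type := EuclideanSpace ℝ (Fin d × Fin N)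

variable {d N : ℕ}

/-- The pointwise gradient of a (differentiable, or almost everywhere differentiable) mapping. -/
def gradMat (u : Vec d → Vec N) (x : Vec d) : Mat d N :=
  WithLp.toLp 2 fun p : Fin d × Fin N => (fderiv ℝ u x (EuclideanSpace.single p.1 1)) p.2

/-- The pointwise divergence of a matrix field, `(Div φ)_i = ∑_k ∂φ_{k,i}/∂x_k`. -/
def divMat (φ : Vec d → Mat d N) (x : Vec d) : Vec N :=
  WithLp.toLp 2 fun i : Fin N => ∑ k : Fin d, (fderiv ℝ φ x (EuclideanSpace.single k 1)) (k, i)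

/-- `q ∈ L¹(U)` has the weak gradient `w ∈ L¹(U)` in the open set `U`. -/
def HasWeakGrad (U : Set (Vec d)) (q : Vec d → Vec N) (w : Vec d → Mat d N) : Prop :=
  IntegrableOn q U ∧ IntegrableOn w U ∧
    ∀ φ : Vec d → Mat d N, ContDiff ℝ ∞ φ → HasCompactSupport φ → tsupport φ ⊆ U →
      ∫ x in U, inner ℝ (w x) (φ x) = -∫ x in U, inner ℝ (q x) (divMat φ x)

/-- The `(d-1)`-dimensional surface measure (Hausdorff measure, with the Euclidean
normalization). -/
def surfaceMeasure (d : ℕ) : Measure (Vec d) := Measure.euclideanHausdorffMeasure (d - 1)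

/-- `t ∈ L¹(∂U)` is the trace of the Sobolev function `q ∈ W^{1,1}(U)` on the boundary of the
Lipschitz set `U`: the trace operator is the continuous extension, from `W^{1,1}(U)` to `L¹(∂U)`,
of the restriction to `∂U` of functions that are smooth up to the boundary. -/
def HasTrace (U : Set (Vec d)) (q t : Vec d → Vec N) : Prop :=
  IntegrableOn t (frontier U) (surfaceMeasure d) ∧
  ∃ w : Vec d → Mat d N, HasWeakGrad U q w ∧
  ∃ u : ℕ → Vec d → Vec N, (∀ n, ContDiff ℝ ∞ (u n)) ∧
    Tendsto (fun n => ∫⁻ x in U, ‖u n x - q x‖ₑ) atTop (𝓝 0) ∧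
    Tendsto (fun n => ∫⁻ x in U, ‖gradMat (u n) x - w x‖ₑ) atTop (𝓝 0) ∧
    Tendsto (fun n => ∫⁻ x in frontier U, ‖u n x - t x‖ₑ ∂(surfaceMeasure d)) atTop (𝓝 0)

/-- Near each boundary point, `U` is the strict epigraph of a Lipschitz function of the
coordinates orthogonal to some unit vector `e`. -/
def IsLipschitzSet (U : Set (Vec d)) : Prop :=
  ∀ x ∈ frontier U, ∃ (e : Vec d) (γ : Vec d → ℝ) (K : ℝ≥0) (r : ℝ),
    ‖e‖ = 1 ∧ LipschitzWith K γ ∧ 0 < r ∧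
    ∀ y ∈ Metric.ball x r, y ∈ U ↔ γ (y - (inner ℝ e y : ℝ) • e) < inner ℝ e y

/-- `A` is relatively open in `B`. -/
def IsRelOpen (A B : Set (Vec d)) : Prop := ∃ O : Set (Vec d), IsOpen O ∧ A = O ∩ B

/-- The geometric setting: a bounded Lipschitz domain `Ω ⊆ ℝ^d`, `d ≥ 2`, whose boundary splits
into `Γ_N` and `Γ_D = Γ_D¹ ∪ Γ_D²`, and which is bisected by the interface `Γ` into the Lipschitz
domains `Ω₁` (adjacent to `Γ_D¹`) and `Ω₂` (adjacent to `Γ_D²`). -/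
structure InterfaceDomain (d : ℕ) where
  two_le : 2 ≤ d
  (Ω Ω₁ Ω₂ Γ ΓN ΓD₁ ΓD₂ : Set (Vec d))
  isOpen : IsOpen Ω
  isBounded : Bornology.IsBounded Ω
  isConnected : IsConnected Ω
  isLipschitz : IsLipschitzSet Ω
  frontier_eq : frontier Ω = closure ΓN ∪ closure (ΓD₁ ∪ ΓD₂)
  relOpen_N : IsRelOpen ΓN (frontier Ω)
  relOpen_D : IsRelOpen (ΓD₁ ∪ ΓD₂) (frontier Ω)
  disjoint_ND : Disjoint ΓN (ΓD₁ ∪ ΓD₂)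
  isConnected_D₁ : IsConnected ΓD₁
  isConnected_D₂ : IsConnected ΓD₂
  separated_D₁ : Disjoint (closure ΓD₁) ΓD₂
  separated_D₂ : Disjoint ΓD₁ (closure ΓD₂)
  pos_D₁ : 0 < surfaceMeasure d ΓD₁
  pos_D₂ : 0 < surfaceMeasure d ΓD₂
  interface_subset : Γ ⊆ Ω
  isConnected_interface : IsConnected Γ
  bisected : Ω \ Γ = Ω₁ ∪ Ω₂
  disjoint_pieces : Disjoint Ω₁ Ω₂
  isOpen₁ : IsOpen Ω₁
  isOpen₂ : IsOpen Ω₂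
  isConnected₁ : IsConnected Ω₁
  isConnected₂ : IsConnected Ω₂
  isLipschitz₁ : IsLipschitzSet Ω₁
  isLipschitz₂ : IsLipschitzSet Ω₂
  interface_subset₁ : Γ ⊆ frontier Ω₁
  interface_subset₂ : Γ ⊆ frontier Ω₂
  separates₁ : ΓD₁ ⊆ frontier Ω₁
  separates₂ : ΓD₂ ⊆ frontier Ω₂

namespace InterfaceDomain

variable (D : InterfaceDomain d)

/-- The Dirichlet part of the boundary. -/
def ΓD : Set (Vec d) := D.ΓD₁ ∪ D.ΓD₂

/-- Lebesgue measure on `Ω`. -/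
def vol : Measure (Vec d) := volume.restrict D.Ω

/-- Surface measure on `Γ`. -/
def surf : Measure (Vec d) := (surfaceMeasure d).restrict D.Γ

/-- `∇q = w`: the gradient that does not see jumps across `Γ` (the interface is a Lebesgue null
set). -/
def HasGrad (q : Vec d → Vec N) (w : Vec d → Mat d N) : Prop := HasWeakGrad (D.Ω \ D.Γ) q w

/-- `[q] = s`: the trace on `Γ` from `Ω₂` minus the trace on `Γ` from `Ω₁`. -/
def HasJump (q s : Vec d → Vec N) : Prop :=
  ∃ t₁ t₂ : Vec d → Vec N, HasTrace D.Ω₁ q t₁ ∧ HasTrace D.Ω₂ q t₂ ∧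
    s =ᵐ[D.surf] fun x => t₂ x - t₁ x

/-- The traces of `q` from `Ω₁` and from `Ω₂` vanish on `Γ_D`. -/
def VanishesOnΓD (q : Vec d → Vec N) : Prop :=
  (∃ t₁, HasTrace D.Ω₁ q t₁ ∧
    ∀ᵐ x ∂((surfaceMeasure d).restrict (frontier D.Ω₁ ∩ D.ΓD)), t₁ x = 0) ∧
  ∃ t₂, HasTrace D.Ω₂ q t₂ ∧
    ∀ᵐ x ∂((surfaceMeasure d).restrict (frontier D.Ω₂ ∩ D.ΓD)), t₂ x = 0

/-! ### The spaces `P`, `EP`, `BP` -/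

/-- `q ∈ P`, with `∇q = w` and `[q] = s`. -/
structure MemP (Φ : Vec d → Mat d N → ℝ) (Ψ : Vec d → Vec N → ℝ)
    (q : Vec d → Vec N) (w : Vec d → Mat d N) (s : Vec d → Vec N) : Prop where
  grad : D.HasGrad q w
  grad_mem : w ∈ orliczL D.vol Φ
  jump : D.HasJump q s
  jump_mem : s ∈ orliczL D.surf Ψ
  vanishes : D.VanishesOnΓD q

/-- `q ∈ EP`, with `∇q = w` and `[q] = s`. -/
structure MemEP (Φ : Vec d → Mat d N → ℝ) (Ψ : Vec d → Vec N → ℝ)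
    (q : Vec d → Vec N) (w : Vec d → Mat d N) (s : Vec d → Vec N) : Prop where
  memP : D.MemP Φ Ψ q w s
  grad_memE : w ∈ orliczE D.vol Φ
  jump_memE : s ∈ orliczE D.surf Ψ

/-- Weak-star convergence in `L^Υ = (E^{Υ*})*`; `Υ'` stands for the complementary function. -/
def WeakStarTendsto {V : Type*} [NormedAddCommGroup V] [InnerProductSpace ℝ V] [MeasurableSpace V]
    (μ : Measure (Vec d)) (Υ' : Vec d → V → ℝ) (v : ℕ → Vec d → V) (v₀ : Vec d → V) : Prop :=
  ∀ η ∈ orliczE μ Υ', Tendsto (fun n => ∫ x, inner ℝ (v n x) (η x) ∂μ) atTop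
    (𝓝 (∫ x, inner ℝ (v₀ x) (η x) ∂μ))

/-- `q ∈ BP`, with `∇q = w` and `[q] = s`. -/
def MemBP (Φ : Vec d → Mat d N → ℝ) (Ψ : Vec d → Vec N → ℝ)
    (q : Vec d → Vec N) (w : Vec d → Mat d N) (s : Vec d → Vec N) : Prop :=
  D.MemP Φ Ψ q w s ∧
  ∃ (qn : ℕ → Vec d → Vec N) (wn : ℕ → Vec d → Mat d N) (sn : ℕ → Vec d → Vec N),
    (∀ n, D.MemEP Φ Ψ (qn n) (wn n) (sn n)) ∧
    WeakStarTendsto D.vol (conj Φ) wn w ∧ WeakStarTendsto D.surf (conj Ψ) sn s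

/-! ### Normal fluxes and the spaces `X`, `EX`, `BX` -/

/-- Lipschitz test functions with compact support in `Ω`. Their pointwise gradient exists almost
everywhere. -/
def IsTestFun (φ : Vec d → Vec N) : Prop :=
  (∃ K : ℝ≥0, LipschitzWith K φ) ∧ HasCompactSupport φ ∧ tsupport φ ⊆ D.Ω

/-- `τ · n = β` on `Γ`, where `n` is the unit normal pointing outwards from `Ω₁`. -/
def HasNormalFlux (τ : Vec d → Mat d N) (β : Vec d → Vec N) : Prop :=
  IntegrableOn τ D.Ω₁ ∧ Integrable β D.surf ∧
    ∀ φ : Vec d → Vec N, D.IsTestFun φ →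
      ∫ x, inner ℝ (β x) (φ x) ∂D.surf = ∫ x in D.Ω₁, inner ℝ (gradMat φ x) (τ x)

/-- `Div τ = 0` in `Ω`. -/
def IsDivFree (τ : Vec d → Mat d N) : Prop :=
  IntegrableOn τ D.Ω ∧ ∀ φ : Vec d → Vec N, D.IsTestFun φ →
    ∫ x in D.Ω, inner ℝ (gradMat φ x) (τ x) = 0

/-- `τ ∈ X`, with `τ · n = β` on `Γ`. -/
structure MemX (Φ : Vec d → Mat d N → ℝ) (Ψ : Vec d → Vec N → ℝ)
    (τ : Vec d → Mat d N) (β : Vec d → Vec N) : Prop where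
  mem : τ ∈ orliczL D.vol (conj Φ)
  flux : D.HasNormalFlux τ β
  flux_mem : β ∈ orliczL D.surf (conj Ψ)
  orthogonal : ∀ (q : Vec d → Vec N) (w : Vec d → Mat d N) (s : Vec d → Vec N),
    D.MemEP Φ Ψ q w s →
      (∫ x, inner ℝ (β x) (s x) ∂D.surf) + ∫ x, inner ℝ (w x) (τ x) ∂D.vol = 0

/-- `τ ∈ EX`, with `τ · n = β` on `Γ`. -/
structure MemEX (Φ : Vec d → Mat d N → ℝ) (Ψ : Vec d → Vec N → ℝ)
    (τ : Vec d → Mat d N) (β : Vec d → Vec N) : Prop where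
  memX : D.MemX Φ Ψ τ β
  memE : τ ∈ orliczE D.vol (conj Φ)
  flux_memE : β ∈ orliczE D.surf (conj Ψ)

/-- `τ ∈ BX`, with `τ · n = β` on `Γ`. -/
def MemBX (Φ : Vec d → Mat d N → ℝ) (Ψ : Vec d → Vec N → ℝ)
    (τ : Vec d → Mat d N) (β : Vec d → Vec N) : Prop :=
  D.MemX Φ Ψ τ β ∧
  ∃ (τn : ℕ → Vec d → Mat d N) (βn : ℕ → Vec d → Vec N),
    (∀ n, D.MemEX Φ Ψ (τn n) (βn n)) ∧
    WeakStarTendsto D.vol Φ τn τ ∧ WeakStarTendsto D.surf Ψ βn β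

/-! ### Assumptions on nonlinearities and data -/

/-- The standing assumptions on the pair of N-functions: `Φ` on `Ω` and `Ψ` on `Γ` are
N-functions, and they and their complementary functions are integrable in `x`. -/
structure NFunctionPair (Φ : Vec d → Mat d N → ℝ) (Ψ : Vec d → Vec N → ℝ) : Prop where
  nfun_Φ : IsNFunction D.vol Φ
  nfun_Ψ : IsNFunction D.surf Ψ
  int_Φ : HasIntegrableSections D.vol Φ
  int_Φ' : HasIntegrableSections D.vol (conj Φ)
  int_Ψ : HasIntegrableSections D.surf Ψ
  int_Ψ' : HasIntegrableSections D.surf (conj Ψ)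

/-- At least one of the couples `(Φ, Ψ)` and `(Φ*, Ψ*)` satisfies the `Δ₂` condition. -/
def DeltaCondition (Φ : Vec d → Mat d N → ℝ) (Ψ : Vec d → Vec N → ℝ) : Prop :=
  (Delta2 D.vol Φ ∧ Delta2 D.surf Ψ) ∨ (Delta2 D.vol (conj Φ) ∧ Delta2 D.surf (conj Ψ))

/-- Monotonicity and coercivity of `h` and `b`. -/
structure PrimalAssumptions (Φ : Vec d → Mat d N → ℝ) (Ψ : Vec d → Vec N → ℝ)
    (h : Vec d → Mat d N → Mat d N) (b : Vec d → Vec N → Vec N) : Prop where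
  mono_h : IsMonotoneMap D.vol h
  mono_b : IsMonotoneMap D.surf b
  coercive_h : IsCoercive D.vol Φ h
  coercive_b : IsCoercive D.surf Ψ b

/-- Monotonicity and coercivity of `f` and `g`. -/
structure DualAssumptions (Φ : Vec d → Mat d N → ℝ) (Ψ : Vec d → Vec N → ℝ)
    (f : Vec d → Mat d N → Mat d N) (g : Vec d → Vec N → Vec N) : Prop where
  mono_f : IsMonotoneMap D.vol f
  mono_g : IsMonotoneMap D.surf g
  coercive_f : IsDualCoercive D.vol Φ f
  coercive_g : IsDualCoercive D.surf Ψ g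

/-- `φ₀ ∈ W^{1,1}(Ω)` with `∇φ₀ ∈ E^Φ(Ω)`. -/
def DirichletData (Φ : Vec d → Mat d N → ℝ) (φ₀ : Vec d → Vec N) : Prop :=
  ∃ w₀ : Vec d → Mat d N, HasWeakGrad D.Ω φ₀ w₀ ∧ w₀ ∈ orliczE D.vol Φ

/-- `j₀ ∈ E^{Φ*}(Ω)` with `j₀ · n = 0` on `Γ` and `Div j₀ = 0` in `Ω`. -/
def NeumannData (Φ : Vec d → Mat d N → ℝ) (j₀ : Vec d → Mat d N) : Prop :=
  j₀ ∈ orliczE D.vol (conj Φ) ∧ D.HasNormalFlux j₀ 0 ∧ D.IsDivFree j₀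

/-! ### The four notions of solution -/

/-- `φ` is a weak solution of the problem for `h`, `b`; here `w = ∇φ` and `s = [φ]`. -/
def IsWeakSolution (Φ : Vec d → Mat d N → ℝ) (Ψ : Vec d → Vec N → ℝ)
    (h : Vec d → Mat d N → Mat d N) (b : Vec d → Vec N → Vec N)
    (φ₀ : Vec d → Vec N) (j₀ : Vec d → Mat d N) (φ : Vec d → Vec N) : Prop :=
  (∃ w' s', D.MemP Φ Ψ (φ - φ₀) w' s') ∧
  ∃ (w : Vec d → Mat d N) (s : Vec d → Vec N), D.HasGrad φ w ∧ D.HasJump φ s ∧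
    (fun x => h x (w x)) ∈ orliczL D.vol (conj Φ) ∧
    (fun x => b x (s x)) ∈ orliczL D.surf (conj Ψ) ∧
    ∀ (q : Vec d → Vec N) (wq : Vec d → Mat d N) (sq : Vec d → Vec N), D.MemEP Φ Ψ q wq sq →
      (∫ x, inner ℝ (h x (w x)) (wq x) ∂D.vol) + ∫ x, inner ℝ (b x (s x)) (sq x) ∂D.surf =
        ∫ x, inner ℝ (j₀ x) (wq x) ∂D.vol

/-- `φ` is a variational weak solution of the problem for `h`, `b`; here `w = ∇φ`, `w₀ = ∇φ₀` and
`s = [φ]`. No integrability of `h(∇φ)` or `b([φ])` is imposed. -/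
def IsVariationalWeakSolution (Φ : Vec d → Mat d N → ℝ) (Ψ : Vec d → Vec N → ℝ)
    (h : Vec d → Mat d N → Mat d N) (b : Vec d → Vec N → Vec N)
    (φ₀ : Vec d → Vec N) (j₀ : Vec d → Mat d N) (φ : Vec d → Vec N) : Prop :=
  (∃ w' s', D.MemP Φ Ψ (φ - φ₀) w' s') ∧
  ∃ (w w₀ : Vec d → Mat d N) (s : Vec d → Vec N),
    D.HasGrad φ w ∧ D.HasGrad φ₀ w₀ ∧ D.HasJump φ s ∧
    ∀ (q : Vec d → Vec N) (wq : Vec d → Mat d N) (sq : Vec d → Vec N), D.MemEP Φ Ψ q wq sq →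
      extIntegral D.vol (fun x => inner ℝ (h x (w x) - j₀ x) (w x - w₀ x - wq x)) +
        extIntegral D.surf (fun x => inner ℝ (b x (s x)) (s x - sq x)) ≤ 0

/-- `j` is a weak solution of the flux problem for `f`, `g`; here `w₀ = ∇φ₀` and `β = j · n`. -/
def IsWeakFlux (Φ : Vec d → Mat d N → ℝ) (Ψ : Vec d → Vec N → ℝ)
    (f : Vec d → Mat d N → Mat d N) (g : Vec d → Vec N → Vec N)
    (φ₀ : Vec d → Vec N) (j₀ j : Vec d → Mat d N) : Prop :=
  (∃ β', D.MemX Φ Ψ (j - j₀) β') ∧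
  ∃ (w₀ : Vec d → Mat d N) (β : Vec d → Vec N), D.HasGrad φ₀ w₀ ∧ D.HasNormalFlux j β ∧
    (fun x => f x (j x)) ∈ orliczL D.vol Φ ∧
    (fun x => g x (β x)) ∈ orliczL D.surf Ψ ∧
    ∀ (τ : Vec d → Mat d N) (βτ : Vec d → Vec N), D.MemEX Φ Ψ τ βτ →
      (∫ x, inner ℝ (f x (j x)) (τ x) ∂D.vol) + ∫ x, inner ℝ (g x (β x)) (βτ x) ∂D.surf =
        ∫ x, inner ℝ (w₀ x) (τ x) ∂D.vol

/-- `j` is a variational weak solution of the flux problem for `f`, `g`; here `w₀ = ∇φ₀` and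
`β = j · n`. No integrability of `f(j)` or `g(j · n)` is imposed. -/
def IsVariationalWeakFlux (Φ : Vec d → Mat d N → ℝ) (Ψ : Vec d → Vec N → ℝ)
    (f : Vec d → Mat d N → Mat d N) (g : Vec d → Vec N → Vec N)
    (φ₀ : Vec d → Vec N) (j₀ j : Vec d → Mat d N) : Prop :=
  (∃ β', D.MemX Φ Ψ (j - j₀) β') ∧
  ∃ (w₀ : Vec d → Mat d N) (β : Vec d → Vec N), D.HasGrad φ₀ w₀ ∧ D.HasNormalFlux j β ∧
    ∀ (τ : Vec d → Mat d N) (βτ : Vec d → Vec N), D.MemEX Φ Ψ τ βτ →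
      extIntegral D.vol (fun x => inner ℝ (f x (j x) - w₀ x) (j x - j₀ x - τ x)) +
        extIntegral D.surf (fun x => inner ℝ (g x (β x)) (β x - βτ x)) ≤ 0

end InterfaceDomain

end InterfaceProblem

end

open InterfaceProblem

/-!
The primal problem for `h, b` and the flux problem for `f, g` are two instances of one statement
about a Young pair `(A, B)` on the bulk and a Young pair `(A', B')` on the interface: `(Φ, Φ*)` and
`(Ψ, Ψ*)` in the first case, the same pairs in the opposite order in the second. Its two halves are
`weak_of_variational` and `variational_of_weak`.

A variational solution is tested with zero first. Coercivity and the Young inequality, with the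
data in `E^A` and `E^B`, bound both integrands below by integrable functions, so the two extended
integrals exceed `-∞`; as their sum is nonpositive, both are finite, which gives the energy bound
and places the nonlinear terms in `L^B` and `L^B'`. Now every term is integrable, the left-hand side
of the inequality is an affine function of the factor `t` when the test pair is `t • p`, and an
affine function on `ℝ` that is bounded above is constant: this is the weak equation.

Conversely a weak solution has to be tested with its own difference to the data, which belongs to
`BP` (or `BX`). By `IsYoungFunction.mem_orliczE_of_delta2`, `Δ₂` gives `L = E`. If it holds for `A`
and `A'`, the difference lies in the test space itself. If it holds for `B` and `B'`, the nonlinear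
terms lie in the spaces `E` against which weak-star convergence is tested, and the equation passes
to the limit. In both cases equality holds in the variational inequality.

The Orlicz part rests on `IsYoungFunction.mem_orliczL_iff` and `IsYoungFunction.mem_orliczE_iff`,
which describe `L^A` and `E^A` by finiteness of some, respectively all, modulars of multiples.

In order to identify gradients, jumps and fluxes that are only given by their defining properties,
uniqueness is needed: for weak gradients and normal fluxes it is the fundamental lemma of the
calculus of variations, for traces it is `HasTrace.unique`. The latter follows from a divergence
theorem in the one direction `e` in which a Lipschitz domain is locally an epigraph
(`integral_epigraph_fderiv`, by Fubini), since the surface measure of a Lipschitz graph and the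
Lebesgue measure of the hyperplane orthogonal to `e` have the same null sets. The same formula on
the two sides of `Γ` shows that a Sobolev function on `Ω` has no jump
(`HasJump.eq_zero_of_hasWeakGrad`), whence `[φ] = [φ - φ₀]`.
-/

namespace InterfaceProblem

/-! ### Musielak–Orlicz spaces of Young pairs -/

section Orlicz

variable {X V : Type*} [MeasurableSpace X] [NormedAddCommGroup V] [InnerProductSpace ℝ V]
  {μ : Measure X}

/-- The convexity-type properties that an N-function shares with its complementary function. -/
structure IsYoungFunction (μ : Measure X) (A : X → V → ℝ) : Prop where
  convex : ∀ᵐ x ∂μ, ConvexOn ℝ univ (A x)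
  even : ∀ᵐ x ∂μ, ∀ z, A x (-z) = A x z
  nonneg : ∀ᵐ x ∂μ, ∀ z, 0 ≤ A x z
  zero : ∀ᵐ x ∂μ, A x 0 = 0
  integrable : HasIntegrableSections μ A

/-- Two Young functions linked by the Young inequality. The notion is symmetric in `A` and `B`,
so that the problem for `h, b` and the flux problem for `f, g` are instances of one statement. -/
structure IsYoungPair (μ : Measure X) (A B : X → V → ℝ) : Prop where
  left : IsYoungFunction μ A
  right : IsYoungFunction μ B
  young : ∀ᵐ x ∂μ, ∀ y z, inner ℝ y z ≤ A x y + B x z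

theorem IsYoungPair.symm {A B : X → V → ℝ} (h : IsYoungPair μ A B) : IsYoungPair μ B A where
  left := h.right
  right := h.left
  young := by
    filter_upwards [h.young] with x hx y z
    rw [real_inner_comm, add_comm]
    exact hx z y

/-- Superposition of a Carathéodory mapping with a measurable function is measurable. -/
theorem aemeasurable_superposition {E W : Type*} [TopologicalSpace E]
    [TopologicalSpace.MetrizableSpace E] [SecondCountableTopology E] [MeasurableSpace E]
    [BorelSpace E] [TopologicalSpace W] [TopologicalSpace.PseudoMetrizableSpace W]
    [MeasurableSpace W] [BorelSpace W] {a : X → E → W} (hc : ∀ᵐ x ∂μ, Continuous (a x))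
    (hm : ∀ z, AEMeasurable (fun x => a x z) μ) {u : X → E} (hu : AEMeasurable u μ) :
    AEMeasurable (fun x => a x (u x)) μ := by
  have h_str : StronglyMeasurable (id : E → E) := stronglyMeasurable_id
  refine aemeasurable_of_tendsto_metrizable_ae atTop
    (f := fun n x => a x (h_str.approx n (u x))) (fun n => ?_) ?_
  · -- On each of the finitely many level sets of the simple function, this is a section of `a`.
    set s := h_str.approx n
    have key : ∀ z ∈ s.range, AEMeasurable (fun x => a x (s (u x)))
        (μ.restrict {x | s (u x) = z}) := by
      intro z _
      have h1 : NullMeasurableSet {x | s (u x) = z} μ :=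
        (s.measurable.comp_aemeasurable hu).nullMeasurableSet_preimage
          (measurableSet_singleton z)
      refine ((hm z).restrict).congr ?_
      filter_upwards [ae_restrict_mem₀ h1] with x hx
      exact congrArg (a x) (Eq.symm hx)
    have hU : (⋃ z : s.range, {x | s (u x) = z}) = univ := by
      ext x
      simp
    rw [← Measure.restrict_univ (μ := μ), ← hU, aemeasurable_iUnion_iff]
    exact fun z => key z z.2
  · filter_upwards [hc] with x hx
    exact (hx.tendsto _).comp (h_str.tendsto_approx (u x))

namespace IsYoungFunction

variable {A : X → V → ℝ}

theorem smul_le (hA : IsYoungFunction μ A) :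
    ∀ᵐ x ∂μ, ∀ t : ℝ, |t| ≤ 1 → ∀ z, A x (t • z) ≤ |t| * A x z := by
  filter_upwards [hA.convex, hA.even, hA.zero] with x hc he h0 t ht z
  have key : ∀ t : ℝ, 0 ≤ t → t ≤ 1 → A x (t • z) ≤ t * A x z := by
    intro t ht0 ht1
    have := hc.2 (mem_univ z) (mem_univ 0) ht0 (sub_nonneg.2 ht1) (by ring)
    simpa [h0] using this
  rcases abs_cases t with ⟨h, h'⟩ | ⟨h, h'⟩
  · rw [h] at ht ⊢
    exact key t h' ht
  · rw [h] at ht ⊢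
    have := key (-t) (by linarith) ht
    rwa [neg_smul, he] at this

theorem smul_mono (hA : IsYoungFunction μ A) :
    ∀ᵐ x ∂μ, ∀ s t : ℝ, |s| ≤ |t| → ∀ z, A x (s • z) ≤ A x (t • z) := by
  filter_upwards [hA.smul_le, hA.nonneg] with x hs hn s t hst z
  rcases eq_or_ne t 0 with rfl | ht
  · have : s = 0 := by simpa using hst
    rw [this]
  · have h1 : |s / t| ≤ 1 := by
      rw [abs_div]
      exact div_le_one_of_le₀ hst (abs_nonneg _)
    have := hs (s / t) h1 (t • z)
    rw [smul_smul, div_mul_cancel₀ _ ht] at this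
    exact this.trans (mul_le_of_le_one_left (hn _) h1)

theorem add_le (hA : IsYoungFunction μ A) :
    ∀ᵐ x ∂μ, ∀ y z, A x (y + z) ≤ A x ((2 : ℝ) • y) + A x ((2 : ℝ) • z) := by
  filter_upwards [hA.convex, hA.nonneg] with x hc hn y z
  have := hc.2 (mem_univ ((2 : ℝ) • y)) (mem_univ ((2 : ℝ) • z)) 
    (by norm_num : (0 : ℝ) ≤ 1 / 2) (by norm_num : (0 : ℝ) ≤ 1 / 2) (by norm_num)
  simp only [smul_smul, smul_eq_mul] at this
  norm_num at this
  linarith [hn ((2 : ℝ) • y), hn ((2 : ℝ) • z)]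

variable [FiniteDimensional ℝ V]

/-- On balls, a Young function is dominated by finitely many of its sections: by convexity it is
enough to control it on the vertices of a cross-polytope. -/
theorem exists_bound (hA : IsYoungFunction μ A) (M : ℝ) :
    ∃ g : X → ℝ, Integrable g μ ∧ ∀ᵐ x ∂μ, ∀ z, ‖z‖ ≤ M → A x z ≤ g x := by
  set b := stdOrthonormalBasis ℝ V
  set n := Module.finrank ℝ V
  refine ⟨fun x => ∑ i, A x ((n * M : ℝ) • b i),
    integrable_finsetSum _ fun i _ => hA.integrable _, ?_⟩
  filter_upwards [hA.convex, hA.nonneg, hA.smul_mono, hA.zero] with x hc hn hs h0 z hz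
  rcases Nat.eq_zero_or_pos n with h | h
  · have : Subsingleton V := Module.finrank_zero_iff.1 h
    rw [Subsingleton.elim z 0, h0]
    exact Finset.sum_nonneg fun i _ => hn _
  have hn' : (0 : ℝ) < n := by exact_mod_cast h
  have hz' : z = ∑ i, (1 / n : ℝ) • ((n * inner ℝ (b i) z : ℝ) • b i) := by
    conv_lhs => rw [← b.sum_repr' z]
    refine Finset.sum_congr rfl fun i _ => ?_
    rw [smul_smul]
    congr 1
    field_simp
  have hj := hc.map_sum_le (t := Finset.univ) (w := fun _ => (1 / n : ℝ))
    (p := fun i => (n * inner ℝ (b i) z : ℝ) • b i) (fun _ _ => by positivity)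
    (by simp [n, hn'.ne']) (fun _ _ => mem_univ _)
  rw [← hz'] at hj
  refine hj.trans (Finset.sum_le_sum fun i _ => ?_)
  rw [smul_eq_mul]
  have h1 : A x ((n * inner ℝ (b i) z : ℝ) • b i) ≤ A x ((n * M : ℝ) • b i) := by
    refine hs _ _ ?_ _
    rw [abs_mul, abs_mul]
    have : |inner ℝ (b i) z| ≤ |M| := by
      refine (abs_real_inner_le_norm _ _).trans ?_
      rw [b.norm_eq_one, one_mul]
      exact hz.trans (le_abs_self M)
    gcongr
  have h2 : (1 / n : ℝ) ≤ 1 := by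
    rw [div_le_one hn']
    exact_mod_cast h
  exact (mul_le_of_le_one_left (hn _) h2).trans h1

variable [MeasurableSpace V] [BorelSpace V]

theorem aemeasurable (hA : IsYoungFunction μ A) {u : X → V} (hu : AEMeasurable u μ) :
    AEMeasurable (fun x => A x (u x)) μ :=
  aemeasurable_superposition
    (hA.convex.mono fun _ hx => continuousOn_univ.1 (hx.continuousOn isOpen_univ))
    (fun z => (hA.integrable z).aemeasurable) hu

theorem integrable_of_le (hA : IsYoungFunction μ A) {u : X → V} (hu : AEMeasurable u μ)
    {g : X → ℝ} (hg : Integrable g μ) (h : ∀ᵐ x ∂μ, A x (u x) ≤ g x) :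
    Integrable (fun x => A x (u x)) μ := by
  refine hg.mono' (hA.aemeasurable hu).aestronglyMeasurable ?_
  filter_upwards [h, hA.nonneg] with x hx hn
  rwa [Real.norm_of_nonneg (hn _)]

theorem lintegral_lt_top_iff (hA : IsYoungFunction μ A) {u : X → V} (hu : AEMeasurable u μ) :
    ∫⁻ x, ENNReal.ofReal (A x (u x)) ∂μ < ⊤ ↔ Integrable (fun x => A x (u x)) μ := by
  have hn : 0 ≤ᵐ[μ] fun x => A x (u x) := hA.nonneg.mono fun x hx => hx _
  constructor
  · intro h
    exact ⟨(hA.aemeasurable hu).aestronglyMeasurable, (hasFiniteIntegral_iff_ofReal hn).2 h⟩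
  · exact fun h => (hasFiniteIntegral_iff_ofReal hn).1 h.2

theorem integrable_smul_of_abs_le (hA : IsYoungFunction μ A) {u : X → V} (hu : AEMeasurable u μ)
    {s t : ℝ} (hst : |s| ≤ |t|) (h : Integrable (fun x => A x (t • u x)) μ) :
    Integrable (fun x => A x (s • u x)) μ :=
  hA.integrable_of_le (hu.const_smul s) h (hA.smul_mono.mono fun _ hx => hx _ _ hst _)

theorem integrable_add (hA : IsYoungFunction μ A) {u v : X → V} (hu : AEMeasurable u μ)
    (hv : AEMeasurable v μ) (h : Integrable (fun x => A x ((2 : ℝ) • u x)) μ)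
    (h' : Integrable (fun x => A x ((2 : ℝ) • v x)) μ) :
    Integrable (fun x => A x (u x + v x)) μ :=
  hA.integrable_of_le (hu.add hv) (h.add h') (hA.add_le.mono fun _ hx => hx _ _)

theorem mem_orliczL_iff (hA : IsYoungFunction μ A) {v : X → V} :
    v ∈ orliczL μ A ↔
      Integrable v μ ∧ ∃ l : ℝ, 0 < l ∧ Integrable (fun x => A x (l • v x)) μ := by
  constructor
  · intro hv
    refine Submodule.span_induction ?_ ?_ ?_ ?_ hv
    · intro u hu
      refine ⟨hu.1, 1, one_pos, ?_⟩
      simpa using (hA.lintegral_lt_top_iff hu.1.aemeasurable).1 hu.2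
    · refine ⟨integrable_zero _ _ _, 1, one_pos, ?_⟩
      simpa using hA.integrable 0
    · rintro u v - - ⟨hu, l, hl, h⟩ ⟨hv, l', hl', h'⟩
      refine ⟨hu.add hv, min l l' / 2, by positivity, ?_⟩
      simp only [Pi.add_apply, smul_add]
      have hm : 0 < min l l' := lt_min hl hl'
      refine hA.integrable_add (hu.aemeasurable.const_smul _) (hv.aemeasurable.const_smul _) ?_ ?_
      · simp only [smul_smul]
        refine hA.integrable_smul_of_abs_le hu.aemeasurable ?_ h
        rw [mul_div_cancel₀ _ two_ne_zero, abs_of_pos hm, abs_of_pos hl]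
        exact min_le_left _ _
      · simp only [smul_smul]
        refine hA.integrable_smul_of_abs_le hv.aemeasurable ?_ h'
        rw [mul_div_cancel₀ _ two_ne_zero, abs_of_pos hm, abs_of_pos hl']
        exact min_le_right _ _
    · rintro c u - ⟨hu, l, hl, h⟩
      have hc : 0 < |c| + 1 := by positivity
      refine ⟨hu.smul c, l / (|c| + 1), by positivity, ?_⟩
      simp only [Pi.smul_apply, smul_smul]
      refine hA.integrable_smul_of_abs_le hu.aemeasurable ?_ h
      rw [abs_mul, abs_div, abs_of_pos hc, div_mul_eq_mul_div, div_le_iff₀ hc]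
      gcongr
      linarith
  · rintro ⟨hv, l, hl, h⟩
    have : (fun x => l • v x) ∈ orliczM μ A :=
      ⟨hv.smul l, (hA.lintegral_lt_top_iff (hv.aemeasurable.const_smul l)).2 h⟩
    have h2 := (orliczL μ A).smul_mem l⁻¹ (Submodule.subset_span this)
    convert h2 using 1
    ext x
    simp [smul_smul, inv_mul_cancel₀ hl.ne']

/-- A function lies in `L^A` and has Luxemburg norm below `ε` only if it has modular at most one
after division by some `l < ε`; membership in `L^A` rules out the value `sInf ∅ = 0`. -/
theorem exists_of_luxNorm_lt (hA : IsYoungFunction μ A) {v : X → V} (hv : v ∈ orliczL μ A)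
    {ε : ℝ} (h : luxNorm μ A v < ε) :
    ∃ l : ℝ, 0 < l ∧ l < ε ∧ Integrable (fun x => A x (l⁻¹ • v x)) μ := by
  obtain ⟨hi, l, hl, hl'⟩ := hA.mem_orliczL_iff.1 hv
  have hne : {l : ℝ | 0 < l ∧ ∫⁻ x, ENNReal.ofReal (A x (l⁻¹ • v x)) ∂μ ≤ 1}.Nonempty := by
    set I := ∫ x, A x (l • v x) ∂μ
    have hI : 0 ≤ I := integral_nonneg_of_ae (hA.nonneg.mono fun x hx => hx _)
    have hI1 : 0 < I + 1 := by linarith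
    have ht1 : |1 / (I + 1)| ≤ 1 := by
      rw [abs_of_nonneg (by positivity), div_le_one hI1]
      linarith
    refine ⟨(I + 1) / l, by positivity, ?_⟩
    calc ∫⁻ x, ENNReal.ofReal (A x (((I + 1) / l)⁻¹ • v x)) ∂μ
        ≤ ∫⁻ x, ENNReal.ofReal (1 / (I + 1) * A x (l • v x)) ∂μ := by
          refine lintegral_mono_ae ?_
          filter_upwards [hA.smul_le] with x hx
          refine ENNReal.ofReal_le_ofReal ?_
          have := hx _ ht1 (l • v x)
          rw [abs_of_nonneg (by positivity), smul_smul] at this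
          convert this using 3
          rw [inv_div]
          ring
      _ = ENNReal.ofReal (1 / (I + 1) * I) := by
          rw [← ofReal_integral_eq_lintegral_ofReal (hl'.const_mul _), integral_const_mul]
          filter_upwards [hA.nonneg] with x hx
          exact mul_nonneg (by positivity) (hx _)
      _ ≤ 1 := by
          refine ENNReal.ofReal_le_one.2 ?_
          rw [one_div, inv_mul_le_iff₀ hI1]
          linarith
  obtain ⟨l', ⟨h1, h2⟩, h3⟩ := exists_lt_of_csInf_lt hne h
  exact ⟨l', h1, h3, (hA.lintegral_lt_top_iff (hi.aemeasurable.const_smul _)).1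
    (h2.trans_lt ENNReal.one_lt_top)⟩

theorem integrable_of_memLp_top (hA : IsYoungFunction μ A) {u : X → V} (hu : MemLp u ⊤ μ) :
    Integrable (fun x => A x (u x)) μ := by
  obtain ⟨g, hg, hb⟩ := hA.exists_bound (eLpNorm u ⊤ μ).toReal
  refine hA.integrable_of_le hu.1.aemeasurable hg ?_
  filter_upwards [hb, ae_le_eLpNormEssSup (f := u) (μ := μ)] with x hx h
  refine hx _ ?_
  rw [eLpNorm_exponent_top, ← toReal_enorm]
  exact ENNReal.toReal_mono (by simpa using hu.2.ne) h

/-- `E^A` consists of the functions all of whose multiples have finite modular. -/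
theorem mem_orliczE_iff (hA : IsYoungFunction μ A) {v : X → V} :
    v ∈ orliczE μ A ↔ Integrable v μ ∧ ∀ l : ℝ, Integrable (fun x => A x (l • v x)) μ := by
  constructor
  · rintro ⟨hv, h⟩
    have hvi := (hA.mem_orliczL_iff.1 hv).1
    refine ⟨hvi, fun l => ?_⟩
    have hl : 0 < 2 * |l| + 1 := by positivity
    obtain ⟨u, hu, huL, hlt⟩ := h (1 / (2 * |l| + 1)) (by positivity)
    obtain ⟨m, hm, hm', hi⟩ := hA.exists_of_luxNorm_lt (Submodule.sub_mem _ hv huL) hlt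
    have hui := (hA.mem_orliczL_iff.1 huL).1
    have heq : (fun x => A x (l • v x)) = fun x => A x (l • (v - u) x + l • u x) := by
      ext x
      rw [← smul_add]
      simp
    rw [heq]
    refine hA.integrable_add ((hvi.sub hui).aemeasurable.const_smul _)
      (hui.aemeasurable.const_smul _) ?_ ?_
    · simp only [smul_smul]
      refine hA.integrable_smul_of_abs_le (hvi.sub hui).aemeasurable ?_ hi
      have : 2 * |l| + 1 < m⁻¹ := by
        rw [lt_inv_comm₀ hl hm]
        simpa using hm'
      rw [abs_mul, abs_two, abs_of_pos (inv_pos.2 hm)]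
      linarith
    · simp only [smul_smul]
      exact hA.integrable_of_memLp_top (hu.const_smul (2 * l))
  · rintro ⟨hv, h⟩
    have hvL : v ∈ orliczL μ A := hA.mem_orliczL_iff.2 ⟨hv, 1, one_pos, h 1⟩
    refine ⟨hvL, fun ε hε => ?_⟩
    -- Approximation by truncation, with the modular of the tails of `v` controlled by dominated
    -- convergence.
    set w := hv.aestronglyMeasurable.mk v
    have hwm : StronglyMeasurable w := hv.aestronglyMeasurable.stronglyMeasurable_mk
    have hwv : v =ᵐ[μ] w := hv.aestronglyMeasurable.ae_eq_mk
    set S : ℕ → Set X := fun n => {x | ‖w x‖ ≤ n}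
    have hS : ∀ n, MeasurableSet (S n) := fun n =>
      measurableSet_le hwm.norm.measurable measurable_const
    set δ := ε / 2
    have hδ : 0 < δ := by positivity
    have hlim : Tendsto (fun n => ∫ x, (S n)ᶜ.indicator (fun x => A x (δ⁻¹ • v x)) x ∂μ) atTop
        (𝓝 (∫ x, (0 : ℝ) ∂μ)) := by
      refine tendsto_integral_of_dominated_convergence (fun x => A x (δ⁻¹ • v x))
        (fun n => ((h _).indicator (hS n).compl).aestronglyMeasurable) (h _) (fun n => ?_) ?_
      · filter_upwards [hA.nonneg] with x hx
        rw [norm_indicator_eq_indicator_norm]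
        refine indicator_le_self' (fun _ _ => norm_nonneg _) x |>.trans ?_
        rw [Real.norm_of_nonneg (hx _)]
      · refine Eventually.of_forall fun x => tendsto_const_nhds.congr' ?_
        obtain ⟨n₀, hn₀⟩ := exists_nat_ge ‖w x‖
        filter_upwards [eventually_ge_atTop n₀] with n hn
        rw [indicator_of_notMem]
        have : ‖w x‖ ≤ n := hn₀.trans (by exact_mod_cast hn)
        simpa [S] using this
    rw [integral_zero] at hlim
    obtain ⟨n, hn⟩ := (hlim.eventually (gt_mem_nhds one_pos)).exists
    have hind : ∀ l : ℝ, (fun x => A x (l • (S n).indicator w x)) ≤ᵐ[μ] fun x => A x (l • v x) := by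
      intro l
      filter_upwards [hA.nonneg, hA.zero, hwv] with x hx h0 he
      by_cases hxS : x ∈ S n
      · simp [hxS, he]
      · simp [hxS, h0, hx]
    have huL : (S n).indicator w ∈ orliczL μ A := by
      refine hA.mem_orliczL_iff.2 ⟨(hv.congr hwv).indicator (hS n), 1, one_pos, ?_⟩
      exact hA.integrable_of_le
        (((hv.congr hwv).indicator (hS n)).aemeasurable.const_smul _) (h 1) (hind 1)
    refine ⟨(S n).indicator w, ?_, huL, ?_⟩
    · refine memLp_top_of_bound ((hwm.indicator (hS n)).aestronglyMeasurable) n ?_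
      refine Eventually.of_forall fun x => ?_
      by_cases hxS : x ∈ S n
      · rw [indicator_of_mem hxS]
        exact hxS
      · simp [hxS]
    · refine lt_of_le_of_lt (csInf_le ⟨0, fun l hl => hl.1.le⟩ ⟨hδ, ?_⟩) (half_lt_self hε)
      have heq : ∀ᵐ x ∂μ, ENNReal.ofReal (A x (δ⁻¹ • (v - (S n).indicator w) x)) =
          ENNReal.ofReal ((S n)ᶜ.indicator (fun x => A x (δ⁻¹ • v x)) x) := by
        filter_upwards [hA.zero, hwv] with x h0 he
        by_cases hxS : x ∈ S n
        · simp [hxS, he, h0]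
        · simp [hxS]
      rw [lintegral_congr_ae heq, ← ofReal_integral_eq_lintegral_ofReal
        ((h _).indicator (hS n).compl)]
      · exact ENNReal.ofReal_le_one.2 hn.le
      · filter_upwards [hA.nonneg] with x hx
        exact indicator_nonneg (fun _ _ => hx _) x

theorem orliczE_congr (hA : IsYoungFunction μ A) {u v : X → V} (huv : u =ᵐ[μ] v)
    (hu : u ∈ orliczE μ A) : v ∈ orliczE μ A := by
  obtain ⟨h, hi⟩ := hA.mem_orliczE_iff.1 hu
  exact hA.mem_orliczE_iff.2
    ⟨h.congr huv, fun l => (hi l).congr (huv.mono fun x hx => by simp only [hx])⟩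

theorem smul_mem_orliczE (hA : IsYoungFunction μ A) {u : X → V} (hu : u ∈ orliczE μ A) (c : ℝ) :
    c • u ∈ orliczE μ A := by
  obtain ⟨h, hi⟩ := hA.mem_orliczE_iff.1 hu
  refine hA.mem_orliczE_iff.2 ⟨h.smul c, fun l => ?_⟩
  simpa only [Pi.smul_apply, smul_smul] using hi (l * c)

theorem zero_mem_orliczE (hA : IsYoungFunction μ A) : (0 : X → V) ∈ orliczE μ A :=
  hA.mem_orliczE_iff.2 ⟨integrable_zero _ _ _, fun l => by simpa using hA.integrable 0⟩

/-- Under `Δ₂` a finite modular stays finite under doubling, hence `L^A = E^A`. -/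
theorem mem_orliczE_of_delta2 (hA : IsYoungFunction μ A) (hΔ : Delta2 μ A) {v : X → V}
    (hv : v ∈ orliczL μ A) : v ∈ orliczE μ A := by
  obtain ⟨hvi, l, hl, hli⟩ := hA.mem_orliczL_iff.1 hv
  obtain ⟨c, K, hc, hK, hcK⟩ := hΔ
  obtain ⟨g, hg, hb⟩ := hA.exists_bound (2 * K)
  have step : ∀ k : ℕ, Integrable (fun x => A x (((2 : ℝ) ^ k * l) • v x)) μ := by
    intro k
    induction k with
    | zero => simpa using hli
    | succ k ih =>
      refine hA.integrable_of_le (hvi.aemeasurable.const_smul _) (hg.norm.add (ih.const_mul c)) ?_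
      filter_upwards [hb, hcK, hA.nonneg] with x hx hx' hn
      have h2 : ((2 : ℝ) ^ (k + 1) * l) • v x = (2 : ℝ) • (((2 : ℝ) ^ k * l) • v x) := by
        rw [smul_smul]
        ring_nf
      rw [h2]
      simp only [Pi.add_apply]
      rcases le_or_gt ‖((2 : ℝ) ^ k * l) • v x‖ K with h | h
      · have := hx ((2 : ℝ) • (((2 : ℝ) ^ k * l) • v x)) (by
          rw [norm_smul, Real.norm_two]
          gcongr)
        linarith [le_abs_self (g x), Real.norm_eq_abs (g x),
          mul_nonneg hc.le (hn (((2 : ℝ) ^ k * l) • v x))]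
      · linarith [hx' _ h, norm_nonneg (g x)]
  refine hA.mem_orliczE_iff.2 ⟨hvi, fun m => ?_⟩
  obtain ⟨k, hk⟩ := pow_unbounded_of_one_lt (|m| / l) (one_lt_two (α := ℝ))
  refine hA.integrable_smul_of_abs_le hvi.aemeasurable ?_ (step k)
  rw [abs_of_pos (by positivity : (0 : ℝ) < 2 ^ k * l)]
  exact ((div_lt_iff₀ hl).1 hk).le

end IsYoungFunction

namespace IsYoungPair

variable {A B : X → V → ℝ}

theorem abs_inner_le (h : IsYoungPair μ A B) :
    ∀ᵐ x ∂μ, ∀ y z, |inner ℝ y z| ≤ A x y + B x z := by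
  filter_upwards [h.young, h.left.even] with x hx he y z
  refine abs_le'.2 ⟨hx y z, ?_⟩
  have := hx (-y) z
  rwa [inner_neg_left, he] at this

/-- Integrability of the sections of a Young pair forces the measure to be finite, since
`‖z‖² ≤ A x z + B x z`. -/
theorem isFiniteMeasure [Nontrivial V] (h : IsYoungPair μ A B) : IsFiniteMeasure μ := by
  obtain ⟨z, hz⟩ := exists_norm_eq V (zero_le_one (α := ℝ))
  have : Integrable (fun _ : X => (1 : ℝ)) μ := by
    refine ((h.left.integrable z).add (h.right.integrable z)).mono'
      aestronglyMeasurable_const ?_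
    filter_upwards [h.young] with x hx
    have := hx z z
    rw [real_inner_self_eq_norm_sq, hz] at this
    simpa using this
  exact (integrable_const_iff.1 this).resolve_left one_ne_zero

variable [FiniteDimensional ℝ V] [MeasurableSpace V] [BorelSpace V]

theorem integrable_inner (h : IsYoungPair μ A B) {u v : X → V} (hu : u ∈ orliczL μ A)
    (hv : v ∈ orliczL μ B) : Integrable (fun x => inner ℝ (u x) (v x)) μ := by
  obtain ⟨hui, l, hl, hu'⟩ := h.left.mem_orliczL_iff.1 hu
  obtain ⟨hvi, m, hm, hv'⟩ := h.right.mem_orliczL_iff.1 hv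
  refine ((hu'.add hv').const_mul (l⁻¹ * m⁻¹)).mono'
    (hui.aestronglyMeasurable.inner hvi.aestronglyMeasurable) ?_
  filter_upwards [h.abs_inner_le] with x hx
  have := hx (l • u x) (m • v x)
  rw [real_inner_smul_left, real_inner_smul_right, abs_mul, abs_mul, abs_of_pos hl,
    abs_of_pos hm] at this
  rw [Real.norm_eq_abs]
  simp only [Pi.add_apply]
  calc |inner ℝ (u x) (v x)| = l⁻¹ * m⁻¹ * (l * (m * |inner ℝ (u x) (v x)|)) := by
        field_simp
    _ ≤ _ := by gcongr

/-- A measurable function of finite modular is integrable. -/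
theorem integrable_of_modular (h : IsYoungPair μ A B) {u : X → V} (hu : AEMeasurable u μ)
    (hi : Integrable (fun x => A x (u x)) μ) : Integrable u μ := by
  set b := stdOrthonormalBasis ℝ V
  have hg : Integrable (fun x => ∑ i, (A x (u x) + B x (b i))) μ :=
    integrable_finsetSum _ fun i _ => hi.add (h.right.integrable _)
  refine hg.mono' hu.aestronglyMeasurable ?_
  filter_upwards [h.abs_inner_le] with x hx
  calc ‖u x‖ = ‖∑ i, inner ℝ (b i) (u x) • b i‖ := by rw [b.sum_repr']
    _ ≤ ∑ i, ‖inner ℝ (b i) (u x) • b i‖ := norm_sum_le _ _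
    _ ≤ ∑ i, (A x (u x) + B x (b i)) := by
        refine Finset.sum_le_sum fun i _ => ?_
        rw [norm_smul, b.norm_eq_one, mul_one, Real.norm_eq_abs, real_inner_comm]
        exact hx _ _

theorem mem_orliczL_of_modular (h : IsYoungPair μ A B) {u : X → V} (hu : AEMeasurable u μ)
    (hi : Integrable (fun x => A x (u x)) μ) : u ∈ orliczL μ A :=
  h.left.mem_orliczL_iff.2
    ⟨h.integrable_of_modular hu hi, 1, one_pos, by simpa using hi⟩

end IsYoungPair

/-- An N-function and its complementary function form a Young pair. -/
theorem IsNFunction.isYoungPair [Nontrivial V] {Υ : X → V → ℝ} (h : IsNFunction μ Υ)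
    (hi : HasIntegrableSections μ Υ) (hi' : HasIntegrableSections μ (conj Υ)) :
    IsYoungPair μ Υ (conj Υ) := by
  have hzero : ∀ᵐ x ∂μ, Υ x 0 = 0 := by
    filter_upwards [h.caratheodory.continuous, h.tendsto_zero] with x hc ht
    have h1 : Tendsto (Υ x) (𝓝[≠] 0) (𝓝 (0 * ‖(0 : V)‖)) := by
      refine (ht.mul (continuous_norm.tendsto' (0 : V) _ rfl |>.mono_left inf_le_left)).congr' ?_
      filter_upwards [self_mem_nhdsWithin] with z hz
      exact div_mul_cancel₀ _ (norm_ne_zero_iff.2 hz)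
    have : (𝓝[≠] (0 : V)).NeBot := Module.punctured_nhds_neBot ℝ V 0
    have := tendsto_nhds_unique h1 ((hc.tendsto 0).mono_left inf_le_left)
    simpa using this.symm
  have hbdd : ∀ᵐ x ∂μ, ∀ z, BddAbove (range fun y => inner ℝ z y - Υ x y) := by
    filter_upwards [h.nonneg, h.tendsto_infty] with x hn ht z
    have hev : ∀ᶠ y in Bornology.cobounded V, ‖z‖ ≤ Υ x y / ‖y‖ := ht.eventually_ge_atTop _
    obtain ⟨R, -, hR⟩ := (Metric.hasBasis_cobounded_compl_closedBall (0 : V)).eventually_iff.1 hev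
    refine ⟨‖z‖ * |R|, ?_⟩
    rintro _ ⟨y, rfl⟩
    have hzy := real_inner_le_norm z y
    dsimp only
    by_cases hy : ‖y‖ ≤ R
    · have : ‖z‖ * ‖y‖ ≤ ‖z‖ * |R| := by
        gcongr
        exact hy.trans (le_abs_self R)
      linarith [hn y]
    · have h1 := hR (show y ∈ (Metric.closedBall (0 : V) R)ᶜ by simpa using hy)
      rcases eq_or_ne y 0 with rfl | hy0
      · simp only [inner_zero_right]
        linarith [hn 0, mul_nonneg (norm_nonneg z) (abs_nonneg R)]
      · rw [le_div_iff₀ (norm_pos_iff.2 hy0)] at h1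
        linarith [mul_nonneg (norm_nonneg z) (abs_nonneg R)]
  refine ⟨⟨h.convex, h.even, h.nonneg, hzero, hi⟩, ⟨?_, ?_, ?_, ?_, hi'⟩, ?_⟩
  · filter_upwards [hbdd] with x hb
    refine ⟨convex_univ, fun y _ z _ s t hs ht hst => ciSup_le fun v => ?_⟩
    have h1 := le_ciSup (hb y) v
    have h2 := le_ciSup (hb z) v
    have h3 := mul_le_mul_of_nonneg_left h1 hs
    have h4 := mul_le_mul_of_nonneg_left h2 ht
    rw [inner_add_left, real_inner_smul_left, real_inner_smul_left]
    simp only [conj, smul_eq_mul]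
    have h5 : Υ x v = s * Υ x v + t * Υ x v := by rw [← add_mul, hst, one_mul]
    rw [h5]
    linarith
  · filter_upwards [h.even] with x he z
    refine (Equiv.neg V).iSup_congr fun y => ?_
    simp [he]
  · filter_upwards [hbdd, hzero] with x hb h0 z
    have : inner ℝ z 0 - Υ x 0 ≤ conj Υ x z := le_ciSup (hb z) 0
    simpa only [inner_zero_right, h0, sub_zero] using this
  · filter_upwards [hbdd, hzero, h.nonneg] with x hb h0 hn
    refine le_antisymm (ciSup_le fun y => by simpa using hn y) ?_
    have : inner ℝ (0 : V) 0 - Υ x 0 ≤ conj Υ x 0 := le_ciSup (hb 0) 0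
    simpa only [inner_zero_right, h0, sub_zero] using this
  · filter_upwards [hbdd] with x hb y z
    have := le_ciSup (hb z) y
    rw [real_inner_comm]
    simp only [conj]
    linarith

end Orlicz

/-! ### Extended integrals -/

section ExtIntegral

variable {X : Type*} [MeasurableSpace X] {μ : Measure X} {f : X → ℝ}

theorem extIntegral_congr_ae {g : X → ℝ} (h : f =ᵐ[μ] g) : extIntegral μ f = extIntegral μ g := by
  have h1 : ∫⁻ x, ENNReal.ofReal (f x) ∂μ = ∫⁻ x, ENNReal.ofReal (g x) ∂μ :=
    lintegral_congr_ae (h.mono fun x hx => by simp only [hx])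
  have h2 : ∫⁻ x, ENNReal.ofReal (-f x) ∂μ = ∫⁻ x, ENNReal.ofReal (-g x) ∂μ :=
    lintegral_congr_ae (h.mono fun x hx => by simp only [hx])
  rw [extIntegral, extIntegral, h1, h2]

theorem extIntegral_of_integrable (hf : Integrable f μ) :
    extIntegral μ f = ((∫ x, f x ∂μ : ℝ) : EReal) := by
  have h1 : ∫⁻ x, ENNReal.ofReal (f x) ∂μ ≠ ⊤ :=
    ((lintegral_ofReal_le_lintegral_enorm f).trans_lt hf.2).ne
  have h2 : ∫⁻ x, ENNReal.ofReal (-f x) ∂μ ≠ ⊤ :=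
    ((lintegral_ofReal_le_lintegral_enorm _).trans_lt hf.neg.2).ne
  rw [integral_eq_lintegral_pos_part_sub_lintegral_neg_part hf, extIntegral, EReal.coe_sub]
  lift ∫⁻ x, ENNReal.ofReal (f x) ∂μ to ℝ≥0 using h1 with p
  lift ∫⁻ x, ENNReal.ofReal (-f x) ∂μ to ℝ≥0 using h2 with q
  rfl

theorem extIntegral_sub {g : X → ℝ} (hf : Integrable f μ) (hg : Integrable g μ) :
    extIntegral μ (fun x => f x - g x) = (((∫ x, f x ∂μ) - ∫ x, g x ∂μ : ℝ) : EReal) := by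
  rw [← integral_sub hf hg]
  exact extIntegral_of_integrable (hf.sub hg)

/-- The negative part of a function bounded below by an integrable one has finite integral. -/
theorem lintegral_neg_lt_top {G : X → ℝ} (hG : Integrable G μ) (h : ∀ᵐ x ∂μ, -G x ≤ f x) :
    ∫⁻ x, ENNReal.ofReal (-f x) ∂μ < ⊤ := by
  refine lt_of_le_of_lt (lintegral_mono_ae ?_)
    ((lintegral_ofReal_le_lintegral_enorm G).trans_lt hG.2)
  filter_upwards [h] with x hx
  exact ENNReal.ofReal_le_ofReal (by linarith)

theorem extIntegral_ne_bot {G : X → ℝ} (hG : Integrable G μ) (h : ∀ᵐ x ∂μ, -G x ≤ f x) :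
    extIntegral μ f ≠ ⊥ := by
  rw [extIntegral, sub_eq_add_neg, Ne, EReal.add_eq_bot_iff, not_or]
  refine ⟨EReal.coe_ennreal_ne_bot _, ?_⟩
  rw [EReal.neg_eq_bot_iff, EReal.coe_ennreal_eq_top_iff]
  exact (lintegral_neg_lt_top hG h).ne

theorem integrable_of_extIntegral_ne_top {G : X → ℝ} (hf : AEMeasurable f μ)
    (hG : Integrable G μ) (h : ∀ᵐ x ∂μ, -G x ≤ f x) (ht : extIntegral μ f ≠ ⊤) :
    Integrable f μ := by
  have hneg := lintegral_neg_lt_top hG h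
  have hpos : ∫⁻ x, ENNReal.ofReal (f x) ∂μ ≠ ⊤ := by
    intro hp
    apply ht
    rw [extIntegral, hp, sub_eq_add_neg, EReal.coe_ennreal_top]
    refine EReal.top_add_of_ne_bot ?_
    rw [Ne, EReal.neg_eq_bot_iff, EReal.coe_ennreal_eq_top_iff]
    exact hneg.ne
  refine ⟨hf.aestronglyMeasurable, ?_⟩
  rw [hasFiniteIntegral_iff_enorm]
  have : ∀ x, ‖f x‖ₑ ≤ ENNReal.ofReal (f x) + ENNReal.ofReal (-f x) := by
    intro x
    rw [Real.enorm_eq_ofReal_abs]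
    rcases abs_cases (f x) with ⟨h, -⟩ | ⟨h, -⟩ <;> rw [h] <;> simp
  refine (lintegral_mono this).trans_lt ?_
  rw [lintegral_add_left' hf.ennreal_ofReal]
  exact ENNReal.add_lt_top.2 ⟨hpos.lt_top, hneg⟩

end ExtIntegral

/-! ### Variational and weak formulations over a pair of measure spaces -/

section Abstract

variable {X V : Type*} [MeasurableSpace X] [NormedAddCommGroup V] [InnerProductSpace ℝ V]
  {μ : Measure X} {A B : X → V → ℝ} {a : X → V → V}

/-- Coercivity of `a` with respect to a Young pair. With `(A, B) = (Υ, Υ*)` it is the coercivity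
of the primal, with `(A, B) = (Υ*, Υ)` that of the dual nonlinearities. -/
def IsPairCoercive (μ : Measure X) (A B : X → V → ℝ) (a : X → V → V) : Prop :=
  ∃ C α : ℝ, 0 ≤ C ∧ 0 < α ∧ α ≤ 1 ∧ ∀ᵐ x ∂μ, ∀ v,
    α * (B x (a x v) + A x v) - C ≤ inner ℝ (a x v) v

variable [FiniteDimensional ℝ V] [MeasurableSpace V] [BorelSpace V]

theorem IsCaratheodory.aemeasurable_comp (ha : IsCaratheodory μ a) {u : X → V}
    (hu : AEMeasurable u μ) : AEMeasurable (fun x => a x (u x)) μ :=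
  aemeasurable_superposition ha.continuous ha.measurable hu

/-- Half of the coercivity absorbs the contributions of the data, by the Young inequality. -/
theorem IsPairCoercive.exists_lower_bound [IsFiniteMeasure μ] (hp : IsYoungPair μ A B)
    (hco : IsPairCoercive μ A B a) {w₀ j₀ : X → V} (hw₀ : w₀ ∈ orliczE μ A)
    (hj₀ : j₀ ∈ orliczE μ B) (w : X → V) :
    ∃ (c : ℝ) (G : X → ℝ), 0 < c ∧ Integrable G μ ∧ ∀ᵐ x ∂μ,
      c * (B x (a x (w x)) + A x (w x)) - G x ≤ inner ℝ (a x (w x) - j₀ x) (w x - w₀ x) := by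
  obtain ⟨C, α, hC, hα, hα1, hco⟩ := hco
  have hδ : 0 < α / 2 := by positivity
  have hδ1 : |α / 2| ≤ 1 := by
    rw [abs_of_pos hδ]
    linarith
  refine ⟨α / 2, fun x => C + A x ((α / 2)⁻¹ • w₀ x) + B x ((α / 2)⁻¹ • j₀ x) +
    |inner ℝ (w₀ x) (j₀ x)|, hδ, ?_, ?_⟩
  · exact (((integrable_const C).add ((hp.left.mem_orliczE_iff.1 hw₀).2 _)).add
      ((hp.right.mem_orliczE_iff.1 hj₀).2 _)).add (hp.integrable_inner hw₀.1 hj₀.1).abs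
  · filter_upwards [hco, hp.young, hp.left.smul_le, hp.right.smul_le] with x h1 h2 h3 h4
    have e1 := h2 ((α / 2)⁻¹ • w₀ x) ((α / 2) • a x (w x))
    have e2 := h2 ((α / 2) • w x) ((α / 2)⁻¹ • j₀ x)
    have e3 := h3 _ hδ1 (w x)
    have e4 := h4 _ hδ1 (a x (w x))
    rw [abs_of_pos hδ] at e3 e4
    rw [real_inner_smul_left, real_inner_smul_right, inv_mul_cancel_left₀ hδ.ne'] at e1
    rw [real_inner_smul_left, real_inner_smul_right, mul_inv_cancel_left₀ hδ.ne'] at e2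
    rw [inner_sub_left, inner_sub_right, inner_sub_right, real_inner_comm (w₀ x) (a x (w x)),
      real_inner_comm (w x) (j₀ x), real_inner_comm (w₀ x) (j₀ x)]
    rw [real_inner_comm] at e1
    have e5 := h1 (w x)
    have e6 := neg_abs_le (inner ℝ (w₀ x) (j₀ x) : ℝ)
    rw [real_inner_comm (a x (w x)) (w₀ x)] at *
    linarith

/-- Once the extended integral of the tested equation is finite, so are the modulars. -/
theorem IsPairCoercive.integrable_modulars [IsFiniteMeasure μ] (hp : IsYoungPair μ A B)
    (ha : IsCaratheodory μ a) {w w₀ j₀ : X → V} (hw : AEMeasurable w μ)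
    (hw₀ : w₀ ∈ orliczE μ A) (hj₀ : j₀ ∈ orliczE μ B) {c : ℝ} {G : X → ℝ} (hc : 0 < c)
    (hG : Integrable G μ) (hlow : ∀ᵐ x ∂μ,
      c * (B x (a x (w x)) + A x (w x)) - G x ≤ inner ℝ (a x (w x) - j₀ x) (w x - w₀ x))
    (ht : extIntegral μ (fun x => inner ℝ (a x (w x) - j₀ x) (w x - w₀ x)) ≠ ⊤) :
    Integrable (fun x => A x (w x)) μ ∧ Integrable (fun x => B x (a x (w x))) μ := by
  have ham := ha.aemeasurable_comp hw
  have hw₀m := (hp.left.mem_orliczE_iff.1 hw₀).1.aemeasurable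
  have hj₀m := (hp.right.mem_orliczE_iff.1 hj₀).1.aemeasurable
  have hF : Integrable (fun x => (inner ℝ (a x (w x) - j₀ x) (w x - w₀ x) : ℝ)) μ := by
    refine integrable_of_extIntegral_ne_top ((ham.sub hj₀m).inner (hw.sub hw₀m)) hG ?_ ht
    filter_upwards [hlow, hp.left.nonneg, hp.right.nonneg] with x h1 h2 h3
    have := mul_nonneg hc.le (add_nonneg (h3 (a x (w x))) (h2 (w x)))
    linarith
  have hbd := (hF.add hG).const_mul c⁻¹
  have key : ∀ᵐ x ∂μ, B x (a x (w x)) + A x (w x) ≤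
      c⁻¹ * (inner ℝ (a x (w x) - j₀ x) (w x - w₀ x) + G x) := by
    filter_upwards [hlow] with x h1
    rw [le_inv_mul_iff₀ hc]
    linarith
  constructor
  · refine hp.left.integrable_of_le hw hbd ?_
    filter_upwards [key, hp.right.nonneg] with x h1 h2
    exact (le_add_of_nonneg_left (h2 _)).trans h1
  · refine hp.right.integrable_of_le ham hbd ?_
    filter_upwards [key, hp.left.nonneg] with x h1 h2
    exact (le_add_of_nonneg_right (h2 _)).trans h1

variable {Y U : Type*} [MeasurableSpace Y] [NormedAddCommGroup U] [InnerProductSpace ℝ U]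
  [FiniteDimensional ℝ U] [MeasurableSpace U] [BorelSpace U]
  {ν : Measure Y} {A' B' : Y → U → ℝ} {a' : Y → U → U}

/-- Here `T` is the set of admissible test pairs, `w` and `s` stand for the gradient and the jump
(or the flux and its normal component) of the solution, `w₀` and `j₀` for the data.
Testing the variational inequality with zero gives finiteness of all modulars, by
coercivity; testing it with all multiples of a test pair then turns it into an equation. -/
theorem weak_of_variational [IsFiniteMeasure μ] [IsFiniteMeasure ν] (hp : IsYoungPair μ A B)
    (hp' : IsYoungPair ν A' B') (ha : IsCaratheodory μ a) (ha' : IsCaratheodory ν a')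
    (hco : IsPairCoercive μ A B a) (hco' : IsPairCoercive ν A' B' a')
    {T : Set ((X → V) × (Y → U))} (hT₀ : (0, 0) ∈ T)
    (hTs : ∀ (c : ℝ) (p), p ∈ T → c • p ∈ T)
    (hTE : ∀ p ∈ T, p.1 ∈ orliczE μ A ∧ p.2 ∈ orliczE ν A')
    {w w₀ j₀ : X → V} {s : Y → U} (hw : AEMeasurable w μ) (hw₀ : w₀ ∈ orliczE μ A)
    (hj₀ : j₀ ∈ orliczE μ B) (hs : AEMeasurable s ν)
    (hvar : ∀ p ∈ T, extIntegral μ (fun x => inner ℝ (a x (w x) - j₀ x) (w x - w₀ x - p.1 x)) +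
      extIntegral ν (fun x => inner ℝ (a' x (s x)) (s x - p.2 x)) ≤ 0) :
    (Integrable (fun x => A x (w x)) μ ∧ Integrable (fun x => B x (a x (w x))) μ) ∧
    (Integrable (fun x => A' x (s x)) ν ∧ Integrable (fun x => B' x (a' x (s x))) ν) ∧
    ∀ p ∈ T, (∫ x, inner ℝ (a x (w x)) (p.1 x) ∂μ) + ∫ x, inner ℝ (a' x (s x)) (p.2 x) ∂ν =
      ∫ x, inner ℝ (j₀ x) (p.1 x) ∂μ := by
  obtain ⟨c, G, hc, hG, hlow⟩ := hco.exists_lower_bound hp hw₀ hj₀ w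
  obtain ⟨c', G', hc', hG', hlow'⟩ := hco'.exists_lower_bound hp' hp'.left.zero_mem_orliczE
    hp'.right.zero_mem_orliczE s
  have hlb : ∀ᵐ x ∂μ, -G x ≤ inner ℝ (a x (w x) - j₀ x) (w x - w₀ x) := by
    filter_upwards [hlow, hp.left.nonneg, hp.right.nonneg] with x h1 h2 h3
    have := mul_nonneg hc.le (add_nonneg (h3 (a x (w x))) (h2 (w x)))
    linarith
  have hlb' : ∀ᵐ x ∂ν, -G' x ≤ inner ℝ (a' x (s x) - (0 : Y → U) x) (s x - (0 : Y → U) x) := by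
    filter_upwards [hlow', hp'.left.nonneg, hp'.right.nonneg] with x h1 h2 h3
    have := mul_nonneg hc'.le (add_nonneg (h3 (a' x (s x))) (h2 (s x)))
    linarith
  have h0 := hvar _ hT₀
  have e1 : (fun x => (inner ℝ (a x (w x) - j₀ x) (w x - w₀ x - (0 : X → V) x) : ℝ)) =
      fun x => inner ℝ (a x (w x) - j₀ x) (w x - w₀ x) := by
    ext x
    simp
  have e2 : (fun x => (inner ℝ (a' x (s x)) (s x - (0 : Y → U) x) : ℝ)) =
      fun x => inner ℝ (a' x (s x) - (0 : Y → U) x) (s x - (0 : Y → U) x) := by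
    ext x
    simp
  simp only [e1, e2] at h0
  have hnb := extIntegral_ne_bot hG hlb
  have hnb' := extIntegral_ne_bot hG' hlb'
  have ht : extIntegral μ (fun x => inner ℝ (a x (w x) - j₀ x) (w x - w₀ x)) ≠ ⊤ := by
    intro h
    rw [h, EReal.top_add_of_ne_bot hnb'] at h0
    exact absurd h0 (by simp)
  have ht' : extIntegral ν
      (fun x => inner ℝ (a' x (s x) - (0 : Y → U) x) (s x - (0 : Y → U) x)) ≠ ⊤ := by
    intro h
    rw [h, EReal.add_top_of_ne_bot hnb] at h0
    exact absurd h0 (by simp)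
  have hm := IsPairCoercive.integrable_modulars hp ha hw hw₀ hj₀ hc hG hlow ht
  have hm' := IsPairCoercive.integrable_modulars hp' ha' hs hp'.left.zero_mem_orliczE
    hp'.right.zero_mem_orliczE hc' hG' hlow' ht'
  refine ⟨hm, hm', fun p hpT => ?_⟩
  obtain ⟨hp1, hp2⟩ := hTE p hpT
  have hHL := hp.symm.mem_orliczL_of_modular (ha.aemeasurable_comp hw) hm.2
  have hHL' := hp'.symm.mem_orliczL_of_modular (ha'.aemeasurable_comp hs) hm'.2
  have hwL := hp.mem_orliczL_of_modular hw hm.1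
  have hsL := hp'.mem_orliczL_of_modular hs hm'.1
  have hF : Integrable (fun x => (inner ℝ (a x (w x) - j₀ x) (w x - w₀ x) : ℝ)) μ :=
    hp.symm.integrable_inner (Submodule.sub_mem _ hHL hj₀.1) (Submodule.sub_mem _ hwL hw₀.1)
  have hF' : Integrable (fun x => (inner ℝ (a' x (s x)) (s x) : ℝ)) ν :=
    hp'.symm.integrable_inner hHL' hsL
  have hHp := hp.symm.integrable_inner hHL hp1.1
  have hjp := hp.symm.integrable_inner hj₀.1 hp1.1
  have hK : Integrable (fun x => (inner ℝ (a x (w x) - j₀ x) (p.1 x) : ℝ)) μ :=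
    hp.symm.integrable_inner (Submodule.sub_mem _ hHL hj₀.1) hp1.1
  have hK' := hp'.symm.integrable_inner hHL' hp2.1
  set I := (∫ x, (inner ℝ (a x (w x) - j₀ x) (w x - w₀ x) : ℝ) ∂μ) +
    ∫ x, (inner ℝ (a' x (s x)) (s x) : ℝ) ∂ν
  set J := (∫ x, (inner ℝ (a x (w x) - j₀ x) (p.1 x) : ℝ) ∂μ) +
    ∫ x, (inner ℝ (a' x (s x)) (p.2 x) : ℝ) ∂ν with hJ
  have hlin : ∀ t : ℝ, I - t * J ≤ 0 := by
    intro t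
    have h1 := hvar _ (hTs t p hpT)
    have e1 : (fun x => (inner ℝ (a x (w x) - j₀ x) (w x - w₀ x - (t • p).1 x) : ℝ)) =
        fun x => inner ℝ (a x (w x) - j₀ x) (w x - w₀ x) -
          t * inner ℝ (a x (w x) - j₀ x) (p.1 x) := by
      ext x
      rw [Prod.smul_fst, Pi.smul_apply, inner_sub_right _ (w x - w₀ x), real_inner_smul_right]
    have e2 : (fun x => (inner ℝ (a' x (s x)) (s x - (t • p).2 x) : ℝ)) =
        fun x => inner ℝ (a' x (s x)) (s x) - t * inner ℝ (a' x (s x)) (p.2 x) := by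
      ext x
      rw [Prod.smul_snd, Pi.smul_apply, inner_sub_right, real_inner_smul_right]
    rw [e1, e2, extIntegral_sub hF (hK.const_mul t),
      extIntegral_sub hF' (hK'.const_mul t), ← EReal.coe_add, integral_const_mul,
      integral_const_mul] at h1
    have h2 := EReal.coe_nonpos.1 h1
    linarith
  have hJ0 : J = 0 := by
    by_contra hne
    have := hlin ((I - 1) / J)
    rw [div_mul_cancel₀ _ hne] at this
    linarith
  have : ∫ x, (inner ℝ (a x (w x) - j₀ x) (p.1 x) : ℝ) ∂μ =
      (∫ x, inner ℝ (a x (w x)) (p.1 x) ∂μ) - ∫ x, inner ℝ (j₀ x) (p.1 x) ∂μ := by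
    rw [← integral_sub hHp hjp]
    simp only [inner_sub_left]
  rw [this] at hJ
  linarith

/-- Under `Δ₂` for one of the two couples, a weak solution may be tested with itself: either it
belongs to the test space, or its nonlinear images belong to the predual of the space in which it
is a weak-star limit of test pairs. -/
theorem variational_of_weak (hp : IsYoungPair μ A B) (hp' : IsYoungPair ν A' B')
    (hΔ : (Delta2 μ A ∧ Delta2 ν A') ∨ (Delta2 μ B ∧ Delta2 ν B'))
    {T : Set ((X → V) × (Y → U))} (hTE : ∀ p ∈ T, p.1 ∈ orliczE μ A ∧ p.2 ∈ orliczE ν A')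
    {v H j₀ : X → V} {s H' : Y → U} (hv : v ∈ orliczL μ A) (hs : s ∈ orliczL ν A')
    (hH : H ∈ orliczL μ B) (hH' : H' ∈ orliczL ν B') (hj₀ : j₀ ∈ orliczE μ B)
    (hmem : v ∈ orliczE μ A → s ∈ orliczE ν A' → (v, s) ∈ T)
    {p : ℕ → (X → V) × (Y → U)} (hpT : ∀ n, p n ∈ T)
    (hlim : ∀ η ∈ orliczE μ B, Tendsto (fun n => ∫ x, inner ℝ ((p n).1 x) (η x) ∂μ) atTop
      (𝓝 (∫ x, inner ℝ (v x) (η x) ∂μ)))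
    (hlim' : ∀ η ∈ orliczE ν B', Tendsto (fun n => ∫ x, inner ℝ ((p n).2 x) (η x) ∂ν) atTop
      (𝓝 (∫ x, inner ℝ (s x) (η x) ∂ν)))
    (heq : ∀ p ∈ T, (∫ x, inner ℝ (H x) (p.1 x) ∂μ) + ∫ x, inner ℝ (H' x) (p.2 x) ∂ν =
      ∫ x, inner ℝ (j₀ x) (p.1 x) ∂μ) (q : (X → V) × (Y → U)) (hq : q ∈ T) :
    extIntegral μ (fun x => inner ℝ (H x - j₀ x) (v x - q.1 x)) +
      extIntegral ν (fun x => inner ℝ (H' x) (s x - q.2 x)) ≤ 0 := by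
  have key : (∫ x, inner ℝ (H x) (v x) ∂μ) + ∫ x, inner ℝ (H' x) (s x) ∂ν =
      ∫ x, inner ℝ (j₀ x) (v x) ∂μ := by
    rcases hΔ with ⟨hA, hA'⟩ | ⟨hB, hB'⟩
    · exact heq (v, s) (hmem (hp.left.mem_orliczE_of_delta2 hA hv)
        (hp'.left.mem_orliczE_of_delta2 hA' hs))
    · have h1 := hlim H (hp.right.mem_orliczE_of_delta2 hB hH)
      have h2 := hlim' H' (hp'.right.mem_orliczE_of_delta2 hB' hH')
      have h3 := hlim j₀ hj₀
      simp only [real_inner_comm (H _), real_inner_comm (j₀ _)] at h1 h3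
      simp only [real_inner_comm (H' _)] at h2
      refine tendsto_nhds_unique (h1.add h2) (h3.congr fun n => (heq _ (hpT n)).symm)
  obtain ⟨hq1, hq2⟩ := hTE q hq
  have hq_eq := heq q hq
  have i1 := hp.symm.integrable_inner hH hv
  have i2 := hp.symm.integrable_inner hj₀.1 hv
  have i3 := hp.symm.integrable_inner hH hq1.1
  have i4 := hp.symm.integrable_inner hj₀.1 hq1.1
  have i5 := hp'.symm.integrable_inner hH' hs
  have i6 := hp'.symm.integrable_inner hH' hq2.1
  have hHj : (fun x => H x - j₀ x) ∈ orliczL μ B := Submodule.sub_mem _ hH hj₀.1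
  simp only [inner_sub_right (H' _), inner_sub_right (H _ - j₀ _)]
  rw [extIntegral_sub (hp.symm.integrable_inner hHj hv) (hp.symm.integrable_inner hHj hq1.1),
    extIntegral_sub i5 i6, ← EReal.coe_add]
  simp only [inner_sub_left]
  rw [integral_sub i1 i2, integral_sub i3 i4]
  have : (∫ x, inner ℝ (H x) (v x) ∂μ) - (∫ x, inner ℝ (j₀ x) (v x) ∂μ) -
      ((∫ x, inner ℝ (H x) (q.1 x) ∂μ) - ∫ x, inner ℝ (j₀ x) (q.1 x) ∂μ) +
      ((∫ x, inner ℝ (H' x) (s x) ∂ν) - ∫ x, inner ℝ (H' x) (q.2 x) ∂ν) = 0 := by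
    linarith
  rw [this, EReal.coe_zero]

end Abstract

/-! ### Pairings with test functions -/

section Tools

theorem integrable_inner_of_bound {X V : Type*} [MeasurableSpace X] [NormedAddCommGroup V]
    [InnerProductSpace ℝ V] {μ : Measure X} {f g : X → V} {C : ℝ} (hf : Integrable f μ)
    (hg : AEStronglyMeasurable g μ) (hb : ∀ x, ‖g x‖ ≤ C) :
    Integrable (fun x => (inner ℝ (f x) (g x) : ℝ)) μ := by
  refine (hf.norm.mul_const C).mono' (hf.aestronglyMeasurable.inner hg)
    (Eventually.of_forall fun x => ?_)
  exact (norm_inner_le_norm _ _).trans (by gcongr; exact hb x)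

theorem integrable_inner_of_hasCompactSupport {X V : Type*} [TopologicalSpace X]
    [MeasurableSpace X] [OpensMeasurableSpace X] [NormedAddCommGroup V] [InnerProductSpace ℝ V]
    [SecondCountableTopologyEither X V] {μ : Measure X} {f g : X → V}
    (hf : Integrable f μ) (hg : Continuous g) (hc : HasCompactSupport g) :
    Integrable (fun x => (inner ℝ (f x) (g x) : ℝ)) μ := by
  obtain ⟨C, hC⟩ := hg.bounded_above_of_compact_support hc
  exact integrable_inner_of_bound hf hg.aestronglyMeasurable hC

/-- Convergence in `L¹` implies convergence of the pairings with a bounded function. -/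
theorem tendsto_integral_inner_of_lintegral {X V : Type*} [MeasurableSpace X]
    [NormedAddCommGroup V] [InnerProductSpace ℝ V] {μ : Measure X} {f : ℕ → X → V} {f₀ g : X → V}
    {C : ℝ} (hf₀ : Integrable f₀ μ) (hf : ∀ n, AEStronglyMeasurable (f n) μ)
    (hg : AEStronglyMeasurable g μ) (hb : ∀ x, ‖g x‖ ≤ C)
    (h : Tendsto (fun n => ∫⁻ x, ‖f n x - f₀ x‖ₑ ∂μ) atTop (𝓝 0)) :
    (∀ᶠ n in atTop, Integrable (fun x => (inner ℝ (f n x) (g x) : ℝ)) μ) ∧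
    Tendsto (fun n => ∫ x, (inner ℝ (f n x) (g x) : ℝ) ∂μ) atTop
      (𝓝 (∫ x, (inner ℝ (f₀ x) (g x) : ℝ) ∂μ)) := by
  have hint : ∀ᶠ n in atTop, Integrable (fun x => (inner ℝ (f n x) (g x) : ℝ)) μ := by
    filter_upwards [h.eventually (gt_mem_nhds ENNReal.zero_lt_top)] with n hn
    have h1 : Integrable (fun x => f n x - f₀ x) μ := ⟨(hf n).sub hf₀.aestronglyMeasurable, hn⟩
    have h2 : Integrable (f n) μ := by
      refine (h1.add hf₀).congr (Eventually.of_forall fun x => ?_)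
      simp
    exact integrable_inner_of_bound h2 hg hb
  refine ⟨hint, tendsto_integral_of_L1 _
    ((hf₀.aestronglyMeasurable).inner hg) hint ?_⟩
  have h0 : Tendsto (fun n => (∫⁻ x, ‖f n x - f₀ x‖ₑ ∂μ) * ENNReal.ofReal C) atTop
      (𝓝 (0 * ENNReal.ofReal C)) :=
    ENNReal.Tendsto.mul_const h (Or.inr ENNReal.ofReal_ne_top)
  rw [zero_mul] at h0
  refine tendsto_of_tendsto_of_tendsto_of_le_of_le tendsto_const_nhds h0 (fun _ => zero_le)
    fun n => ?_
  dsimp only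
  rw [← lintegral_mul_const' _ _ ENNReal.ofReal_ne_top]
  refine lintegral_mono fun x => ?_
  rw [← inner_sub_left, ← ofReal_norm, ← ofReal_norm,
    ← ENNReal.ofReal_mul (norm_nonneg _)]
  refine ENNReal.ofReal_le_ofReal ((norm_inner_le_norm _ _).trans ?_)
  gcongr
  exact hb x

/-- The fundamental lemma of the calculus of variations, for vector-valued functions. -/
theorem ae_eq_zero_of_forall_integral_inner {E V : Type*} [NormedAddCommGroup E] [NormedSpace ℝ E]
    [FiniteDimensional ℝ E] [MeasurableSpace E] [BorelSpace E] [NormedAddCommGroup V]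
    [InnerProductSpace ℝ V] [CompleteSpace V] {μ : Measure E} {B : Set E} (hB : IsOpen B)
    {f : E → V} (hf : Integrable f μ)
    (h : ∀ (g : E → ℝ), ContDiff ℝ ∞ g → HasCompactSupport g → tsupport g ⊆ B → ∀ c : V,
      ∫ x, (inner ℝ (f x) (g x • c) : ℝ) ∂μ = 0) :
    ∀ᵐ x ∂μ, x ∈ B → f x = 0 := by
  refine hB.ae_eq_zero_of_integral_contDiff_smul_eq_zero
    (hf.locallyIntegrable.locallyIntegrableOn B) fun g hg hgc hgB => ?_
  obtain ⟨C, hC⟩ := hg.continuous.bounded_above_of_compact_support hgc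
  have hi : Integrable (fun x => g x • f x) μ :=
    hf.bdd_smul C hg.continuous.aestronglyMeasurable (Eventually.of_forall hC)
  refine ext_inner_left ℝ fun c => ?_
  rw [← integral_inner hi c, inner_zero_right, ← h g hg hgc hgB c]
  refine integral_congr_ae (Eventually.of_forall fun x => ?_)
  simp only
  rw [real_inner_smul_right, real_inner_smul_right, real_inner_comm]

theorem tendsto_lintegral_zero_of_le_add {X : Type*} [MeasurableSpace X] {μ : Measure X}
    {f g k : ℕ → X → ENNReal} (hf : ∀ n, AEMeasurable (f n) μ) (hk : ∀ n x, k n x ≤ f n x + g n x)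
    (h1 : Tendsto (fun n => ∫⁻ x, f n x ∂μ) atTop (𝓝 0))
    (h2 : Tendsto (fun n => ∫⁻ x, g n x ∂μ) atTop (𝓝 0)) :
    Tendsto (fun n => ∫⁻ x, k n x ∂μ) atTop (𝓝 0) := by
  have h3 := h1.add h2
  rw [add_zero] at h3
  refine tendsto_of_tendsto_of_tendsto_of_le_of_le tendsto_const_nhds h3 (fun _ => zero_le)
    fun n => ?_
  dsimp only
  rw [← lintegral_add_left' (hf n)]
  exact lintegral_mono (hk n)

end Tools

/-! ### Gradients, divergences and weak gradients -/

section Gradient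

variable {d N : ℕ}

/-- The matrix of a linear map, in the convention of `gradMat`. -/
noncomputable def gradLin : (Vec d →L[ℝ] Vec N) →L[ℝ] Mat d N :=
  LinearMap.toContinuousLinearMap
    { toFun := fun A => WithLp.toLp 2 fun p : Fin d × Fin N =>
        (A (EuclideanSpace.single p.1 1)) p.2
      map_add' := fun A B => by ext p; simp
      map_smul' := fun c A => by ext p; simp }

/-- The divergence as a function of the derivative, in the convention of `divMat`. -/
noncomputable def divLin : (Vec d →L[ℝ] Mat d N) →L[ℝ] Vec N :=
  LinearMap.toContinuousLinearMap
    { toFun := fun A => WithLp.toLp 2 fun i : Fin N =>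
        ∑ k : Fin d, (A (EuclideanSpace.single k 1)) (k, i)
      map_add' := fun A B => by ext p; simp [Finset.sum_add_distrib]
      map_smul' := fun c A => by ext p; simp [Finset.mul_sum] }

theorem gradMat_eq (u : Vec d → Vec N) (x : Vec d) : gradMat u x = gradLin (fderiv ℝ u x) := rfl

theorem divMat_eq (φ : Vec d → Mat d N) (x : Vec d) : divMat φ x = divLin (fderiv ℝ φ x) := rfl

theorem continuous_divMat {φ : Vec d → Mat d N} (h : ContDiff ℝ ∞ φ) : Continuous (divMat φ) :=
  divLin.continuous.comp (h.continuous_fderiv (by simp))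

theorem hasCompactSupport_divMat {φ : Vec d → Mat d N} (h : HasCompactSupport φ) :
    HasCompactSupport (divMat φ) :=
  (h.fderiv (𝕜 := ℝ)).comp_left (g := divLin) (map_zero _)

theorem continuous_gradMat {u : Vec d → Vec N} (h : ContDiff ℝ ∞ u) : Continuous (gradMat u) :=
  gradLin.continuous.comp (h.continuous_fderiv (by simp))

theorem gradMat_sub {u v : Vec d → Vec N} (hu : ContDiff ℝ ∞ u) (hv : ContDiff ℝ ∞ v)
    (x : Vec d) : gradMat (fun y => u y - v y) x = gradMat u x - gradMat v x := by
  rw [gradMat_eq, fderiv_fun_sub (hu.differentiable (by simp) x) (hv.differentiable (by simp) x),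
    map_sub]
  rfl

theorem gradMat_const_smul {u : Vec d → Vec N} (hu : ContDiff ℝ ∞ u) (c : ℝ) (x : Vec d) :
    gradMat (fun y => c • u y) x = c • gradMat u x := by
  rw [gradMat_eq, fderiv_fun_const_smul (hu.differentiable (by simp) x), map_smul]
  rfl

/-- The rank-one matrix `e ⊗ c`. -/
def tensor (e : Vec d) (c : Vec N) : Mat d N := WithLp.toLp 2 fun p => e p.1 * c p.2

theorem inner_gradLin_tensor (A : Vec d →L[ℝ] Vec N) (e : Vec d) (c : Vec N) :
    (inner ℝ (gradLin A) (tensor e c) : ℝ) = inner ℝ (A e) c := by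
  have he : A e = ∑ k, e k • A (EuclideanSpace.single k 1) := by
    conv_lhs => rw [← (EuclideanSpace.basisFun (Fin d) ℝ).sum_repr e]
    simp
  rw [he, sum_inner]
  simp only [PiLp.inner_apply, Fintype.sum_prod_type]
  refine Finset.sum_congr rfl fun k _ => Finset.sum_congr rfl fun i _ => ?_
  simp [gradLin, tensor]
  ring

theorem divMat_smul_tensor {ψ : Vec d → ℝ} (hψ : ContDiff ℝ ∞ ψ) (e : Vec d) (c : Vec N)
    (x : Vec d) : divMat (fun y => ψ y • tensor e c) x = fderiv ℝ ψ x e • c := by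
  have he : fderiv ℝ ψ x e = ∑ k, e k * fderiv ℝ ψ x (EuclideanSpace.single k 1) := by
    conv_lhs => rw [← (EuclideanSpace.basisFun (Fin d) ℝ).sum_repr e]
    simp
  rw [divMat_eq, fderiv_smul_const (hψ.differentiable (by simp) x), he]
  ext i
  simp only [divLin, tensor, LinearMap.coe_toContinuousLinearMap', LinearMap.coe_mk,
    AddHom.coe_mk, ContinuousLinearMap.smulRight_apply, PiLp.smul_apply, smul_eq_mul,
    Finset.sum_mul]
  exact Finset.sum_congr rfl fun k _ => by ring

variable {U : Set (Vec d)} {q q' : Vec d → Vec N} {w w' : Vec d → Mat d N}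

theorem HasWeakGrad.sub (h : HasWeakGrad U q w) (h' : HasWeakGrad U q' w') :
    HasWeakGrad U (q - q') (w - w') := by
  refine ⟨h.1.sub h'.1, h.2.1.sub h'.2.1, fun φ h1 h2 h3 => ?_⟩
  have hd := continuous_divMat h1
  have hdc := hasCompactSupport_divMat h2
  simp only [Pi.sub_apply, inner_sub_left]
  rw [integral_sub (integrable_inner_of_hasCompactSupport h.2.1 h1.continuous h2)
      (integrable_inner_of_hasCompactSupport h'.2.1 h1.continuous h2),
    integral_sub (integrable_inner_of_hasCompactSupport h.1 hd hdc)
      (integrable_inner_of_hasCompactSupport h'.1 hd hdc), h.2.2 φ h1 h2 h3, h'.2.2 φ h1 h2 h3]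
  ring

theorem HasWeakGrad.const_smul (h : HasWeakGrad U q w) (c : ℝ) :
    HasWeakGrad U (c • q) (c • w) := by
  refine ⟨h.1.smul c, h.2.1.smul c, fun φ h1 h2 h3 => ?_⟩
  simp only [Pi.smul_apply, real_inner_smul_left, integral_const_mul]
  rw [h.2.2 φ h1 h2 h3]
  ring

theorem HasWeakGrad.zero : HasWeakGrad U (0 : Vec d → Vec N) 0 :=
  ⟨integrable_zero _ _ _, integrable_zero _ _ _, fun φ _ _ _ => by simp⟩

theorem HasWeakGrad.mono (h : HasWeakGrad U q w) {U' : Set (Vec d)} (hU : U' ⊆ U) :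
    HasWeakGrad U' q w := by
  refine ⟨h.1.mono_set hU, h.2.1.mono_set hU, fun φ h1 h2 h3 => ?_⟩
  have key := h.2.2 φ h1 h2 (h3.trans hU)
  have e1 : ∀ x ∉ U', (inner ℝ (w x) (φ x) : ℝ) = 0 := fun x hx => by
    rw [image_eq_zero_of_notMem_tsupport fun h => hx (h3 h), inner_zero_right]
  have e2 : ∀ x ∉ U', (inner ℝ (q x) (divMat φ x) : ℝ) = 0 := fun x hx => by
    have : fderiv ℝ φ x = 0 :=
      image_eq_zero_of_notMem_tsupport fun h => hx (h3 (tsupport_fderiv_subset ℝ h))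
    rw [divMat_eq, this, map_zero, inner_zero_right]
  rw [setIntegral_eq_integral_of_forall_compl_eq_zero e1,
    setIntegral_eq_integral_of_forall_compl_eq_zero e2]
  rwa [setIntegral_eq_integral_of_forall_compl_eq_zero fun x hx => e1 x fun h => hx (hU h),
    setIntegral_eq_integral_of_forall_compl_eq_zero fun x hx => e2 x fun h => hx (hU h)] at key

theorem HasWeakGrad.unique (hU : IsOpen U) (h : HasWeakGrad U q w) (h' : HasWeakGrad U q w') :
    w =ᵐ[volume.restrict U] w' := by
  have key := ae_eq_zero_of_forall_integral_inner hU (h.2.1.sub h'.2.1) fun g hg hgc hgU c => by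
    have h1 : ContDiff ℝ ∞ fun y => g y • c := hg.smul contDiff_const
    have h2 : HasCompactSupport fun y => g y • c := hgc.smul_right
    have h3 : tsupport (fun y => g y • c) ⊆ U := (tsupport_smul_subset_left _ _).trans hgU
    simp only [Pi.sub_apply, inner_sub_left]
    rw [integral_sub (integrable_inner_of_hasCompactSupport h.2.1 h1.continuous h2)
      (integrable_inner_of_hasCompactSupport h'.2.1 h1.continuous h2), h.2.2 _ h1 h2 h3,
      h'.2.2 _ h1 h2 h3, sub_self]
  filter_upwards [key, ae_restrict_mem hU.measurableSet] with x hx hxU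
  exact sub_eq_zero.1 (hx hxU)

/-! ### Traces: linearity -/

variable {t t' : Vec d → Vec N}

theorem HasTrace.sub (h : HasTrace U q t) (h' : HasTrace U q' t') :
    HasTrace U (q - q') (t - t') := by
  obtain ⟨ht, w, hw, u, hu, h1, h2, h3⟩ := h
  obtain ⟨ht', w', hw', u', hu', h1', h2', h3'⟩ := h'
  refine ⟨ht.sub ht', w - w', hw.sub hw', fun n x => u n x - u' n x,
    fun n => (hu n).sub (hu' n), ?_, ?_, ?_⟩
  · refine tendsto_lintegral_zero_of_le_add (fun n => ?_) (fun n x => ?_) h1 h1'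
    · exact ((hu n).continuous.aestronglyMeasurable.sub hw.1.aestronglyMeasurable).enorm
    · rw [Pi.sub_apply, sub_sub_sub_comm]
      exact enorm_sub_le
  · refine tendsto_lintegral_zero_of_le_add (fun n => ?_) (fun n x => ?_) h2 h2'
    · exact ((continuous_gradMat (hu n)).aestronglyMeasurable.sub
        hw.2.1.aestronglyMeasurable).enorm
    · rw [Pi.sub_apply, gradMat_sub (hu n) (hu' n), sub_sub_sub_comm]
      exact enorm_sub_le
  · refine tendsto_lintegral_zero_of_le_add (fun n => ?_) (fun n x => ?_) h3 h3'
    · exact ((hu n).continuous.aestronglyMeasurable.sub ht.aestronglyMeasurable).enorm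
    · rw [Pi.sub_apply, sub_sub_sub_comm]
      exact enorm_sub_le

theorem tendsto_lintegral_enorm_smul {X V : Type*} [MeasurableSpace X] [NormedAddCommGroup V]
    [NormedSpace ℝ V] {μ : Measure X} {f : ℕ → X → V} (c : ℝ)
    (h : Tendsto (fun n => ∫⁻ x, ‖f n x‖ₑ ∂μ) atTop (𝓝 0)) :
    Tendsto (fun n => ∫⁻ x, ‖c • f n x‖ₑ ∂μ) atTop (𝓝 0) := by
  simp only [enorm_smul]
  simp_rw [lintegral_const_mul' ‖c‖ₑ _ enorm_ne_top]
  have := ENNReal.Tendsto.const_mul h (Or.inr (enorm_ne_top (x := c)))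
  rwa [mul_zero] at this

theorem HasTrace.const_smul (h : HasTrace U q t) (c : ℝ) : HasTrace U (c • q) (c • t) := by
  obtain ⟨ht, w, hw, u, hu, h1, h2, h3⟩ := h
  refine ⟨ht.smul c, c • w, hw.const_smul c, fun n x => c • u n x,
    fun n => (hu n).const_smul c, ?_, ?_, ?_⟩
  · simpa only [Pi.smul_apply, ← smul_sub] using tendsto_lintegral_enorm_smul c h1
  · simpa only [Pi.smul_apply, gradMat_const_smul (hu _), ← smul_sub] using
      tendsto_lintegral_enorm_smul c h2
  · simpa only [Pi.smul_apply, ← smul_sub] using tendsto_lintegral_enorm_smul c h3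

theorem HasTrace.zero : HasTrace U (0 : Vec d → Vec N) 0 := by
  refine ⟨integrable_zero _ _ _, 0, HasWeakGrad.zero, fun _ => 0, fun _ => contDiff_const, ?_, ?_,
    ?_⟩
  · simp
  · have : ∀ x, gradMat (0 : Vec d → Vec N) x = 0 := fun x => by
      rw [gradMat_eq, show (0 : Vec d → Vec N) = fun _ => 0 from rfl, fderiv_fun_const,
        Pi.zero_apply, map_zero]
    simp [this]
  · simp

end Gradient

/-! ### Lipschitz graphs -/

section Graph

variable {d : ℕ}

/-- The component of `y` orthogonal to the unit vector `e`. -/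
noncomputable def perp (e y : Vec d) : Vec d := y - (inner ℝ e y : ℝ) • e

/-- The graph map over the hyperplane orthogonal to `e`. -/
noncomputable def graphMap (e : Vec d) (γ : Vec d → ℝ) (p : (ℝ ∙ e)ᗮ) : Vec d :=
  γ p • e + (p : Vec d)

/-- The image of the Lebesgue measure of the hyperplane orthogonal to `e` under the graph map. -/
noncomputable def graphMeasure (e : Vec d) (γ : Vec d → ℝ) : Measure (Vec d) :=
  (volume : Measure (ℝ ∙ e)ᗮ).map (graphMap e γ)

variable {e : Vec d} {γ : Vec d → ℝ}

theorem continuous_perp : Continuous (perp e) := by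
  unfold perp
  fun_prop

theorem inner_smul_add (he : ‖e‖ = 1) (t : ℝ) (p : (ℝ ∙ e)ᗮ) :
    (inner ℝ e (t • e + (p : Vec d)) : ℝ) = t := by
  have hp : (inner ℝ e (p : Vec d) : ℝ) = 0 :=
    Submodule.mem_orthogonal_singleton_iff_inner_right.1 p.2
  rw [inner_add_right, real_inner_smul_right, real_inner_self_eq_norm_sq, he, hp]
  ring

theorem perp_smul_add (he : ‖e‖ = 1) (t : ℝ) (p : (ℝ ∙ e)ᗮ) :
    perp e (t • e + (p : Vec d)) = p := by
  rw [perp, inner_smul_add he, add_sub_cancel_left]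

theorem perp_mem (he : ‖e‖ = 1) (y : Vec d) : perp e y ∈ (ℝ ∙ e)ᗮ := by
  rw [Submodule.mem_orthogonal_singleton_iff_inner_right, perp, inner_sub_right,
    real_inner_smul_right, real_inner_self_eq_norm_sq, he]
  ring

/-- Points of the graph are the images of their projections. -/
theorem graphMap_perp (he : ‖e‖ = 1) {y : Vec d} (hy : γ (perp e y) = inner ℝ e y) :
    graphMap e γ ⟨perp e y, perp_mem he y⟩ = y := by
  simp only [graphMap]
  rw [hy, perp]
  abel

theorem measurable_graphMap (hγ : Continuous γ) : Measurable (graphMap e γ) := by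
  have : Continuous (graphMap e γ) := by
    unfold graphMap
    fun_prop
  exact this.measurable

/-- Cartesian coordinates along `e` and in the hyperplane orthogonal to `e` preserve volume. -/
theorem measurePreserving_smul_add (he : ‖e‖ = 1) :
    MeasurePreserving (fun z : ℝ × (ℝ ∙ e)ᗮ => z.1 • e + (z.2 : Vec d)) := by
  have h1 := (Submodule.measurePreserving_measurableEquivProd (ℝ ∙ e) (0 : Vec d)).symm
  rw [InnerProductSpace.euclideanHausdorffMeasure_eq_volume] at h1
  have h2 : MeasurePreserving (LinearIsometryEquiv.toSpanUnitSingleton (𝕜 := ℝ) e he) :=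
    LinearIsometryEquiv.measurePreserving _
  have h3 := h1.comp (h2.prod (MeasurePreserving.id (volume : Measure (ℝ ∙ e)ᗮ)))
  convert h3 using 1
  · ext1 z
    simp [Submodule.measurableEquivProd_symm_apply]
  · exact Measure.volume_eq_prod _ _

/-- The divergence theorem for derivatives in the direction `e`, on an epigraph: by Fubini, it is
the fundamental theorem of calculus on each line parallel to `e`. -/
theorem integral_epigraph_fderiv (he : ‖e‖ = 1) (hγ : Continuous γ) {g : Vec d → ℝ}
    (hg : ContDiff ℝ 1 g) (hgc : HasCompactSupport g) :
    (∫ y in {y | γ (perp e y) < inner ℝ e y}, fderiv ℝ g y e) = -∫ y, g y ∂graphMeasure e γ ∧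
    (∫ y in {y | inner ℝ e y < γ (perp e y)}, fderiv ℝ g y e) = ∫ y, g y ∂graphMeasure e γ := by
  have hder : Continuous fun y => fderiv ℝ g y e :=
    (hg.continuous_fderiv (by simp)).clm_apply continuous_const
  have hdc : HasCompactSupport fun y => fderiv ℝ g y e := hgc.fderiv_apply (𝕜 := ℝ) e
  have hin : Continuous fun y : Vec d => (inner ℝ e y : ℝ) := by fun_prop
  have hmp := measurePreserving_smul_add he
  -- Fubini for a measurable set whose slices along `e` are prescribed.
  have fub : ∀ (S : Set (Vec d)) (I : (ℝ ∙ e)ᗮ → Set ℝ), MeasurableSet S →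
      (∀ p, MeasurableSet (I p)) → (∀ t p, t • e + ((p : (ℝ ∙ e)ᗮ) : Vec d) ∈ S ↔ t ∈ I p) →
      ∫ y in S, fderiv ℝ g y e =
        ∫ p : (ℝ ∙ e)ᗮ, ∫ t in I p, fderiv ℝ g (t • e + (p : Vec d)) e := by
    intro S I hS hI hSI
    have hint : Integrable (S.indicator fun y => fderiv ℝ g y e) :=
      (hder.integrable_of_hasCompactSupport hdc).indicator hS
    rw [← integral_indicator hS]
    conv_lhs => rw [← hmp.map_eq]
    have hint' := hmp.map_eq ▸ hint
    rw [integral_map hmp.measurable.aemeasurable hint'.aestronglyMeasurable]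
    have hint2 := (integrable_map_measure hint'.aestronglyMeasurable
      hmp.measurable.aemeasurable).1 hint'
    rw [Measure.volume_eq_prod] at hint2 ⊢
    refine (integral_prod_symm _ hint2).trans (integral_congr_ae (Eventually.of_forall fun p => ?_))
    dsimp only
    rw [← integral_indicator (hI p)]
    refine integral_congr_ae (Eventually.of_forall fun t => ?_)
    simp only [Function.comp_apply]
    by_cases h : t ∈ I p
    · rw [indicator_of_mem h, indicator_of_mem ((hSI t p).2 h)]
    · rw [indicator_of_notMem h, indicator_of_notMem (mt (hSI t p).1 h)]
  -- The restriction of `g` to a line parallel to `e`.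
  have hline : ∀ p : (ℝ ∙ e)ᗮ, ContDiff ℝ 1 (fun t : ℝ => g (t • e + (p : Vec d))) ∧
      HasCompactSupport (fun t : ℝ => g (t • e + (p : Vec d))) ∧
      ∀ t : ℝ, deriv (fun t : ℝ => g (t • e + (p : Vec d))) t =
        fderiv ℝ g (t • e + (p : Vec d)) e := by
    intro p
    refine ⟨hg.comp ((contDiff_id.smul contDiff_const).add contDiff_const), ?_, fun t => ?_⟩
    · refine hgc.comp_isClosedEmbedding
        (g := fun t : ℝ => t • e + (p : Vec d)) (Isometry.isClosedEmbedding ?_)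
      refine Isometry.of_dist_eq fun s t => ?_
      rw [dist_add_right, dist_eq_norm, ← sub_smul, norm_smul, he, mul_one, ← dist_eq_norm]
    · have h1 : HasDerivAt (fun t : ℝ => t • e + (p : Vec d)) e t := by
        simpa using ((hasDerivAt_id t).smul_const e).add_const (p : Vec d)
      exact ((hg.differentiable (by simp) _).hasFDerivAt.comp_hasDerivAt t h1).deriv
  have hgm : ∫ y, g y ∂graphMeasure e γ = ∫ p : (ℝ ∙ e)ᗮ, g (γ p • e + (p : Vec d)) :=
    integral_map (measurable_graphMap hγ).aemeasurable hg.continuous.aestronglyMeasurable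
  have hγp : Continuous fun y => γ (perp e y) := hγ.comp continuous_perp
  rw [hgm]
  constructor
  · rw [fub _ (fun p => Ioi (γ p)) (measurableSet_lt hγp.measurable hin.measurable)
      (fun _ => measurableSet_Ioi) (fun t p => by
        simp [perp_smul_add he, inner_smul_add he]), ← integral_neg]
    refine integral_congr_ae (Eventually.of_forall fun p => ?_)
    obtain ⟨h1, h2, h3⟩ := hline p
    simp only [← h3]
    exact h2.integral_Ioi_deriv_eq h1 _
  · rw [fub _ (fun p => Iio (γ p)) (measurableSet_lt hin.measurable hγp.measurable)
      (fun _ => measurableSet_Iio) (fun t p => by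
        simp [perp_smul_add he, inner_smul_add he])]
    refine integral_congr_ae (Eventually.of_forall fun p => ?_)
    obtain ⟨h1, h2, h3⟩ := hline p
    simp only [← h3]
    rw [← integral_Iic_eq_integral_Iio]
    exact h2.integral_Iic_deriv_eq h1 _

theorem finrank_orthogonal_span (he : ‖e‖ = 1) : Module.finrank ℝ (ℝ ∙ e)ᗮ = d - 1 := by
  have h1 := Submodule.finrank_add_finrank_orthogonal (ℝ ∙ e)
  have h0 : e ≠ 0 := by
    rintro rfl
    simp at he
  rw [finrank_span_singleton h0, finrank_euclideanSpace_fin] at h1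
  omega

theorem volume_orthogonal_eq (he : ‖e‖ = 1) :
    (volume : Measure (ℝ ∙ e)ᗮ) = Measure.euclideanHausdorffMeasure (d - 1) := by
  rw [← InnerProductSpace.euclideanHausdorffMeasure_eq_volume, finrank_orthogonal_span he]

theorem euclideanHausdorffMeasure_image_le {E F : Type*} [EMetricSpace E] [MeasurableSpace E]
    [BorelSpace E] [EMetricSpace F] [MeasurableSpace F] [BorelSpace F] {f : E → F} {K : ℝ≥0}
    (hf : LipschitzWith K f) (n : ℕ) (s : Set E) :
    Measure.euclideanHausdorffMeasure n (f '' s) ≤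
      (K : ENNReal) ^ (n : ℝ) * Measure.euclideanHausdorffMeasure n s := by
  simp only [Measure.euclideanHausdorffMeasure_def, Measure.smul_apply, ENNReal.smul_def,
    smul_eq_mul]
  calc _ ≤ _ := mul_le_mul_right (hf.hausdorffMeasure_image_le (Nat.cast_nonneg n) s) _
    _ = _ := by ring

/-- The orthogonal projection onto the hyperplane does not increase surface measure. -/
theorem graphMeasure_le (he : ‖e‖ = 1) (hγ : Continuous γ) {s : Set (Vec d)}
    (hs : MeasurableSet s) : graphMeasure e γ s ≤ surfaceMeasure d s := by
  rw [graphMeasure, Measure.map_apply (measurable_graphMap hγ) hs, volume_orthogonal_eq he]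
  have hP : LipschitzWith 1 ((ℝ ∙ e)ᗮ.orthogonalProjectionOnto) := by
    refine LipschitzWith.of_dist_le_mul fun x y => ?_
    rw [dist_eq_norm, dist_eq_norm, ← map_sub, NNReal.coe_one, one_mul]
    exact Submodule.norm_orthogonalProjectionOnto_apply_le _ _
  have hsub : graphMap e γ ⁻¹' s ⊆ (ℝ ∙ e)ᗮ.orthogonalProjectionOnto '' s := by
    intro p hp
    refine ⟨_, hp, ?_⟩
    rw [graphMap, map_add, Submodule.orthogonalProjectionOnto_mem_subspace_eq_self]
    have : (ℝ ∙ e)ᗮ.orthogonalProjectionOnto (γ p • e) = 0 := by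
      rw [Submodule.orthogonalProjectionOnto_eq_zero_iff, Submodule.orthogonal_orthogonal]
      exact Submodule.smul_mem _ _ (Submodule.mem_span_singleton_self e)
    rw [this, zero_add]
  refine (measure_mono hsub).trans ?_
  simpa [surfaceMeasure] using euclideanHausdorffMeasure_image_le hP (d - 1) s

/-- Graphs of Lipschitz functions over null sets are null sets. -/
theorem surfaceMeasure_graph_eq_zero (he : ‖e‖ = 1) {K : ℝ≥0} (hγ : LipschitzWith K γ)
    {p : Vec d → Prop} (hp : ∀ᵐ y ∂graphMeasure e γ, p y) {s : Set (Vec d)}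
    (hs : ∀ y ∈ s, γ (perp e y) = inner ℝ e y ∧ ¬ p y) : surfaceMeasure d s = 0 := by
  have h1 := ae_of_ae_map (measurable_graphMap hγ.continuous).aemeasurable hp
  have hL : LipschitzWith (K + 1) (graphMap e γ) := by
    refine LipschitzWith.add ?_ (LipschitzWith.subtype_val _)
    refine LipschitzWith.of_dist_le_mul fun x y => ?_
    rw [dist_eq_norm, ← sub_smul, norm_smul, he, mul_one, ← dist_eq_norm]
    exact hγ.dist_le_mul _ _
  have hsub : s ⊆ graphMap e γ '' {x | ¬ p (graphMap e γ x)} := by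
    intro y hy
    obtain ⟨h2, h3⟩ := hs y hy
    refine ⟨_, ?_, graphMap_perp he h2⟩
    rwa [mem_ofPred_eq, graphMap_perp he h2]
  refine measure_mono_null hsub ?_
  refine le_antisymm ((euclideanHausdorffMeasure_image_le hL (d - 1) _).trans ?_) zero_le
  rw [← volume_orthogonal_eq he, show volume {x | ¬ p (graphMap e γ x)} = 0 from h1, mul_zero]

/-- Graphs of continuous functions are Lebesgue null sets, being disjoint from their translates in
the direction `e`. -/
theorem volume_graph_eq_zero (he : ‖e‖ = 1) (hγ : Continuous γ) :
    volume {y : Vec d | γ (perp e y) = inner ℝ e y} = 0 := by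
  have hin : Continuous fun y : Vec d => (inner ℝ e y : ℝ) := by fun_prop
  have hee : (inner ℝ e e : ℝ) = 1 := by rw [real_inner_self_eq_norm_sq, he, one_pow]
  refine Measure.addHaar_eq_zero_of_disjoint_translates volume
    (fun n : ℕ => (1 / ((n : ℝ) + 1)) • e) ?_ ?_
    (isClosed_eq (hγ.comp continuous_perp) hin).measurableSet
  · exact Metric.isBounded_range_of_tendsto _
      (tendsto_one_div_add_atTop_nhds_zero_nat.smul_const e)
  · intro m n hmn
    rw [Function.onFun, Set.disjoint_left]
    rintro z hz1 hz2
    rw [singleton_add] at hz1 hz2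
    obtain ⟨a, ha, rfl⟩ := hz1
    obtain ⟨b, hb, hab⟩ := hz2
    rw [mem_ofPred_eq] at ha hb
    have hb' : b = ((1 / ((m : ℝ) + 1)) - (1 / ((n : ℝ) + 1))) • e + a := by
      rw [sub_smul, sub_add_eq_add_sub, eq_sub_iff_add_eq']
      exact hab
    have hpe : perp e b = perp e a := by
      rw [hb', perp, perp, inner_add_right, real_inner_smul_right, hee, mul_one, add_smul]
      abel
    rw [hpe, ha, hb', inner_add_right, real_inner_smul_right, hee, mul_one] at hb
    have h1 : 1 / ((m : ℝ) + 1) = 1 / ((n : ℝ) + 1) := by linarith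
    rw [one_div, one_div, inv_inj] at h1
    exact hmn (by exact_mod_cast add_right_cancel h1)

end Graph

/-! ### Uniqueness of traces -/

section Trace

variable {d N : ℕ}

/-- `m` represents the boundary of `U` inside the open set `B`, as far as derivatives in the
direction `e` are concerned: the divergence theorem holds with boundary measure `κ m`, and `m` is
dominated by the surface measure on `∂U`. -/
structure IsBoundaryPatch (U B : Set (Vec d)) (e : Vec d) (κ : ℝ) (m : Measure (Vec d)) :
    Prop where
  le : m ≤ (surfaceMeasure d).restrict (frontier U)
  integral_fderiv : ∀ g : Vec d → ℝ, ContDiff ℝ 1 g → HasCompactSupport g → tsupport g ⊆ B →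
    ∫ y in U, fderiv ℝ g y e = κ * ∫ y, g y ∂m

variable {U B : Set (Vec d)} {e : Vec d} {κ : ℝ} {m : Measure (Vec d)} {γ : Vec d → ℝ}

theorem graphMeasure_restrict_le (he : ‖e‖ = 1) (hγ : Continuous γ) (hB : IsOpen B)
    {F : Set (Vec d)} (hF : ∀ y ∈ B, γ (perp e y) = inner ℝ e y → y ∈ F) :
    (graphMeasure e γ).restrict B ≤ (surfaceMeasure d).restrict F := by
  have hin : Continuous fun y : Vec d => (inner ℝ e y : ℝ) := by fun_prop
  have hγp : Continuous fun y => γ (perp e y) := hγ.comp continuous_perp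
  set R := {y : Vec d | γ (perp e y) = inner ℝ e y}
  have hR : MeasurableSet R := (isClosed_eq hγp hin).measurableSet
  have hRc : graphMeasure e γ Rᶜ = 0 := by
    rw [graphMeasure, Measure.map_apply (measurable_graphMap hγ) hR.compl]
    convert measure_empty (μ := (volume : Measure (ℝ ∙ e)ᗮ))
    ext p
    simp [R, graphMap, perp_smul_add he, inner_smul_add he]
  refine Measure.le_iff.2 fun s hs => ?_
  rw [Measure.restrict_apply hs, Measure.restrict_apply hs]
  have hm := (hs.inter hB.measurableSet).inter hR
  calc graphMeasure e γ (s ∩ B) ≤ graphMeasure e γ (s ∩ B ∩ R) + graphMeasure e γ Rᶜ := by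
        refine (measure_mono fun y hy => ?_).trans (measure_union_le _ _)
        by_cases h : y ∈ R
        · exact Or.inl ⟨hy, h⟩
        · exact Or.inr h
    _ ≤ surfaceMeasure d (s ∩ B ∩ R) := by
        rw [hRc, add_zero]
        exact graphMeasure_le he hγ hm
    _ ≤ surfaceMeasure d (s ∩ F) :=
        measure_mono fun y hy => ⟨hy.1.1, hF y hy.1.2 hy.2⟩

/-- In the ball in which `U` is an epigraph, the frontier of `U` is the graph. -/
theorem mem_frontier_iff_of_epigraph (hU : IsOpen U) (he : ‖e‖ = 1) (hγ : Continuous γ)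
    (hB : IsOpen B) (h : ∀ y ∈ B, y ∈ U ↔ γ (perp e y) < inner ℝ e y) {y : Vec d} (hy : y ∈ B) :
    y ∈ frontier U ↔ γ (perp e y) = inner ℝ e y := by
  have hin : Continuous fun y : Vec d => (inner ℝ e y : ℝ) := by fun_prop
  have hγp : Continuous fun y => γ (perp e y) := hγ.comp continuous_perp
  have hee : (inner ℝ e e : ℝ) = 1 := by rw [real_inner_self_eq_norm_sq, he, one_pow]
  rw [hU.frontier_eq]
  constructor
  · rintro ⟨hc, hn⟩
    have h1 := mt (h y hy).2 hn
    refine le_antisymm ?_ (not_lt.1 h1)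
    by_contra! hlt
    obtain ⟨z, ⟨hzB, hz⟩, hzU⟩ := mem_closure_iff.1 hc _ (hB.inter (isOpen_lt hin hγp)) ⟨hy, hlt⟩
    exact lt_asymm hz ((h z hzB).1 hzU)
  · intro heq
    refine ⟨?_, fun hyU => ((h y hy).1 hyU).ne heq⟩
    -- Move upwards along `e`.
    have hlim : Tendsto (fun t : ℝ => y + t • e) (𝓝[>] 0) (𝓝 y) := by
      have : Continuous fun t : ℝ => y + t • e := by fun_prop
      exact (this.tendsto' 0 y (by simp)).mono_left nhdsWithin_le_nhds
    refine mem_closure_of_tendsto hlim ?_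
    filter_upwards [hlim.eventually (hB.mem_nhds hy), self_mem_nhdsWithin] with t ht ht0
    rw [h _ ht]
    have hpe : perp e (y + t • e) = perp e y := by
      rw [perp, perp, inner_add_right, real_inner_smul_right, hee, mul_one, add_smul]
      abel
    rw [hpe, heq, inner_add_right, real_inner_smul_right, hee, mul_one]
    linarith [mem_Ioi.1 ht0]

theorem setIntegral_fderiv_eq_of_tsupport {S : Set (Vec d)} (hU : MeasurableSet U)
    (hS : MeasurableSet S) (h : ∀ y ∈ B, y ∈ U ↔ y ∈ S) {g : Vec d → ℝ} (hg : tsupport g ⊆ B) :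
    ∫ y in U, fderiv ℝ g y e = ∫ y in S, fderiv ℝ g y e := by
  rw [← integral_indicator hU, ← integral_indicator hS]
  refine integral_congr_ae (Eventually.of_forall fun y => ?_)
  by_cases hy : y ∈ B
  · by_cases hyU : y ∈ U
    · rw [indicator_of_mem hyU, indicator_of_mem ((h y hy).1 hyU)]
    · rw [indicator_of_notMem hyU, indicator_of_notMem (mt (h y hy).2 hyU)]
  · have : fderiv ℝ g y = 0 :=
      image_eq_zero_of_notMem_tsupport fun h => hy (hg (tsupport_fderiv_subset ℝ h))
    have h0 : fderiv ℝ g y e = 0 := by rw [this, zero_apply]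
    have h1 : ∀ A : Set (Vec d), A.indicator (fun y => fderiv ℝ g y e) y = 0 := fun A =>
      indicator_apply_eq_zero.2 fun _ => h0
    rw [h1, h1]

theorem integral_restrict_eq_of_tsupport {g : Vec d → ℝ} (hg : tsupport g ⊆ B) :
    ∫ y in B, g y ∂m = ∫ y, g y ∂m :=
  setIntegral_eq_integral_of_forall_compl_eq_zero fun _ hy =>
    image_eq_zero_of_notMem_tsupport fun h => hy (hg h)

theorem isBoundaryPatch_of_epigraph (hU : IsOpen U) (he : ‖e‖ = 1) (hγ : Continuous γ)
    (hB : IsOpen B) (h : ∀ y ∈ B, y ∈ U ↔ γ (perp e y) < inner ℝ e y) :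
    IsBoundaryPatch U B e (-1) ((graphMeasure e γ).restrict B) where
  le := graphMeasure_restrict_le he hγ hB fun _ hy =>
    (mem_frontier_iff_of_epigraph hU he hγ hB h hy).2
  integral_fderiv g hg hgc hgB := by
    have hin : Continuous fun y : Vec d => (inner ℝ e y : ℝ) := by fun_prop
    have hγp : Continuous fun y => γ (perp e y) := hγ.comp continuous_perp
    rw [setIntegral_fderiv_eq_of_tsupport hU.measurableSet (isOpen_lt hγp hin).measurableSet h hgB,
      integral_restrict_eq_of_tsupport hgB, (integral_epigraph_fderiv he hγ hg hgc).1, neg_one_mul]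

theorem isBoundaryPatch_of_hypograph (hU : IsOpen U) (he : ‖e‖ = 1) (hγ : Continuous γ)
    (hB : IsOpen B) (h : ∀ y ∈ B, y ∈ U ↔ inner ℝ e y < γ (perp e y))
    (hF : ∀ y ∈ B, γ (perp e y) = inner ℝ e y → y ∈ frontier U) :
    IsBoundaryPatch U B e 1 ((graphMeasure e γ).restrict B) where
  le := graphMeasure_restrict_le he hγ hB hF
  integral_fderiv g hg hgc hgB := by
    have hin : Continuous fun y : Vec d => (inner ℝ e y : ℝ) := by fun_prop
    have hγp : Continuous fun y => γ (perp e y) := hγ.comp continuous_perp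
    rw [setIntegral_fderiv_eq_of_tsupport hU.measurableSet (isOpen_lt hin hγp).measurableSet h hgB,
      integral_restrict_eq_of_tsupport hgB, (integral_epigraph_fderiv he hγ hg hgc).2, one_mul]

theorem HasTrace.integrable_of_le {q t : Vec d → Vec N} (h : HasTrace U q t)
    (hm : m ≤ (surfaceMeasure d).restrict (frontier U)) : Integrable t m :=
  Integrable.mono_measure h.1 hm

/-- The divergence theorem for Sobolev functions and their traces, obtained by passing to the
limit in the smooth approximations that define the trace. -/
theorem HasTrace.integral_patch (hU : IsOpen U) {q t : Vec d → Vec N} {w : Vec d → Mat d N}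
    (h : HasTrace U q t) (hw : HasWeakGrad U q w) (hm : IsBoundaryPatch U B e κ m)
    {ψ : Vec d → ℝ} (hψ : ContDiff ℝ ∞ ψ) (hψc : HasCompactSupport ψ) (hψB : tsupport ψ ⊆ B)
    (c : Vec N) :
    (∫ y in U, (inner ℝ (w y) (ψ y • tensor e c) : ℝ)) +
      ∫ y in U, (inner ℝ (q y) (fderiv ℝ ψ y e • c) : ℝ) = κ * ∫ y, inner ℝ (t y) (ψ y • c) ∂m := by
  obtain ⟨ht, w', hw', u, hu, h1, h2, h3⟩ := h
  have hww := hw'.unique hU hw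
  have f1 : Continuous fun y => ψ y • tensor e c := hψ.continuous.smul continuous_const
  have f2 : Continuous fun y => fderiv ℝ ψ y e • c :=
    ((hψ.continuous_fderiv (by simp)).clm_apply continuous_const).smul continuous_const
  have f3 : Continuous fun y => ψ y • c := hψ.continuous.smul continuous_const
  obtain ⟨C1, b1⟩ := f1.bounded_above_of_compact_support hψc.smul_right
  obtain ⟨C2, b2⟩ := f2.bounded_above_of_compact_support
    (hψc.fderiv_apply (𝕜 := ℝ) e).smul_right
  obtain ⟨C3, b3⟩ := f3.bounded_above_of_compact_support hψc.smul_right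
  have h3' : Tendsto (fun n => ∫⁻ x, ‖u n x - t x‖ₑ ∂m) atTop (𝓝 0) :=
    tendsto_of_tendsto_of_tendsto_of_le_of_le tendsto_const_nhds h3 (fun _ => zero_le)
      fun n => lintegral_mono' hm.le le_rfl
  obtain ⟨i1, l1⟩ := tendsto_integral_inner_of_lintegral hw'.2.1
    (fun n => (continuous_gradMat (hu n)).aestronglyMeasurable) f1.aestronglyMeasurable b1 h2
  obtain ⟨i2, l2⟩ := tendsto_integral_inner_of_lintegral hw'.1
    (fun n => (hu n).continuous.aestronglyMeasurable) f2.aestronglyMeasurable b2 h1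
  obtain ⟨-, l3⟩ := tendsto_integral_inner_of_lintegral (Integrable.mono_measure ht hm.le)
    (fun n => (hu n).continuous.aestronglyMeasurable) f3.aestronglyMeasurable b3 h3'
  have hcong : ∫ y in U, (inner ℝ (w' y) (ψ y • tensor e c) : ℝ) =
      ∫ y in U, (inner ℝ (w y) (ψ y • tensor e c) : ℝ) :=
    integral_congr_ae (hww.mono fun y hy => by simp only [hy])
  rw [← hcong]
  refine tendsto_nhds_unique_of_eventuallyEq (l1.add l2) (l3.const_mul κ) ?_
  filter_upwards [i1, i2] with n j1 j2
  -- For smooth functions this is the divergence theorem for `ψ ⟪u, c⟫`.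
  have hg : ContDiff ℝ ∞ fun y => (inner ℝ (u n y) (ψ y • c) : ℝ) :=
    (hu n).inner ℝ (hψ.smul contDiff_const)
  have hgs : tsupport (fun y => (inner ℝ (u n y) (ψ y • c) : ℝ)) ⊆ tsupport ψ := by
    refine closure_mono fun y hy => ?_
    rw [Function.mem_support] at hy ⊢
    rintro h0
    simp [h0] at hy
  have key := hm.integral_fderiv _ (hg.of_le (by simp)) (hψc.mono' (subset_closure.trans hgs))
    (hgs.trans hψB)
  rw [← key, ← integral_add j1 j2]
  refine integral_congr_ae (Eventually.of_forall fun y => ?_)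
  have d1 := (hu n).differentiable (by simp) y
  have d2 : DifferentiableAt ℝ (fun y => ψ y • c) y :=
    (hψ.smul contDiff_const).differentiable (by simp) y
  dsimp only
  rw [fderiv_inner_apply ℝ d1 d2, fderiv_smul_const (hψ.differentiable (by simp) y),
    real_inner_smul_right _ (tensor e c), gradMat_eq, inner_gradLin_tensor,
    real_inner_smul_right _ _ (ψ y)]
  simp only [ContinuousLinearMap.smulRight_apply]
  ring

/-- Two integrable functions with the same pairings along a patch agree almost everywhere on it. -/
theorem surfaceMeasure_ne_eq_zero (hB : IsOpen B) (he : ‖e‖ = 1) {K : ℝ≥0}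
    (hγ : LipschitzWith K γ) {t t' : Vec d → Vec N}
    (ht : Integrable t ((graphMeasure e γ).restrict B))
    (ht' : Integrable t' ((graphMeasure e γ).restrict B))
    (h : ∀ ψ : Vec d → ℝ, ContDiff ℝ ∞ ψ → HasCompactSupport ψ → tsupport ψ ⊆ B → ∀ c : Vec N,
      ∫ y in B, (inner ℝ (t y) (ψ y • c) : ℝ) ∂(graphMeasure e γ) =
        ∫ y in B, (inner ℝ (t' y) (ψ y • c) : ℝ) ∂(graphMeasure e γ))
    {s : Set (Vec d)} (hs : ∀ y ∈ s, y ∈ B ∧ γ (perp e y) = inner ℝ e y ∧ t y ≠ t' y) :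
    surfaceMeasure d s = 0 := by
  have key := ae_eq_zero_of_forall_integral_inner hB (ht.sub ht') fun ψ h1 h2 h3 c => by
    have f3 : Continuous fun y => ψ y • c := h1.continuous.smul continuous_const
    simp only [Pi.sub_apply, inner_sub_left]
    rw [integral_sub (integrable_inner_of_hasCompactSupport ht f3 h2.smul_right)
      (integrable_inner_of_hasCompactSupport ht' f3 h2.smul_right), h ψ h1 h2 h3 c, sub_self]
  have key' : ∀ᵐ y ∂graphMeasure e γ, y ∈ B → t y = t' y := by
    filter_upwards [(ae_restrict_iff' hB.measurableSet).1 key] with y hy hyB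
    exact sub_eq_zero.1 (hy hyB hyB)
  refine surfaceMeasure_graph_eq_zero he hγ key' fun y hy => ⟨(hs y hy).2.1, fun hh => ?_⟩
  exact (hs y hy).2.2 (hh (hs y hy).1)

theorem HasTrace.unique (hU : IsOpen U) (hL : IsLipschitzSet U) {q t t' : Vec d → Vec N}
    (h : HasTrace U q t) (h' : HasTrace U q t') :
    t =ᵐ[(surfaceMeasure d).restrict (frontier U)] t' := by
  have hnull : surfaceMeasure d ({y | t y ≠ t' y} ∩ frontier U) = 0 := by
    refine measure_null_of_locally_null _ fun x hx => ?_
    obtain ⟨e, γ, K, r, he, hγ, hr, hUr⟩ := hL x hx.2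
    have hB : IsOpen (Metric.ball x r) := Metric.isOpen_ball
    refine ⟨_, inter_mem_nhdsWithin _ (hB.mem_nhds (Metric.mem_ball_self hr)), ?_⟩
    have hpatch := isBoundaryPatch_of_epigraph hU he hγ.continuous hB hUr
    refine surfaceMeasure_ne_eq_zero hB he hγ (h.integrable_of_le hpatch.le)
      (h'.integrable_of_le hpatch.le) (fun ψ h1 h2 h3 c => ?_) fun y hy =>
        ⟨hy.2, (mem_frontier_iff_of_epigraph hU he hγ.continuous hB hUr hy.2).1 hy.1.2, hy.1.1⟩
    obtain ⟨-, w, hw, -⟩ := id h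
    have e1 := h.integral_patch hU hw hpatch h1 h2 h3 c
    have e2 := h'.integral_patch hU hw hpatch h1 h2 h3 c
    linarith
  rw [Filter.EventuallyEq, ae_restrict_iff' isClosed_frontier.measurableSet]
  refine measure_mono_null (fun y hy => ?_) hnull
  simp only [mem_compl_iff, mem_ofPred_eq, Classical.not_imp] at hy
  exact ⟨hy.2, hy.1⟩

theorem volume_frontier_eq_zero (hU : IsOpen U) (hL : IsLipschitzSet U) :
    volume (frontier U) = 0 := by
  refine measure_null_of_locally_null _ fun x hx => ?_
  obtain ⟨e, γ, K, r, he, hγ, hr, hUr⟩ := hL x hx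
  have hB : IsOpen (Metric.ball x r) := Metric.isOpen_ball
  refine ⟨_, inter_mem_nhdsWithin _ (hB.mem_nhds (Metric.mem_ball_self hr)), ?_⟩
  exact measure_mono_null (fun y hy =>
    (mem_frontier_iff_of_epigraph hU he hγ.continuous hB hUr hy.2).1 hy.1)
    (volume_graph_eq_zero he hγ.continuous)

end Trace

namespace InterfaceDomain

variable {d N : ℕ} {D : InterfaceDomain d}

/-! ### Geometry of the interface -/

theorem disjoint_frontier₁ (D : InterfaceDomain d) : Disjoint (frontier D.Ω₁) D.Ω₂ :=
  (D.disjoint_pieces.symm.closure_right D.isOpen₂).symm.mono_left frontier_subset_closure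

theorem interface_eq (D : InterfaceDomain d) : D.Γ = D.Ω ∩ frontier D.Ω₁ := by
  refine Subset.antisymm (fun y hy => ⟨D.interface_subset hy, D.interface_subset₁ hy⟩) ?_
  rintro y ⟨hyΩ, hyF⟩
  by_contra hyΓ
  rcases D.bisected.subset (⟨hyΩ, hyΓ⟩ : y ∈ D.Ω \ D.Γ) with h | h
  · exact (D.isOpen₁.frontier_eq ▸ hyF).2 h
  · exact Set.disjoint_left.1 D.disjoint_frontier₁ hyF h

theorem measurableSet_interface (D : InterfaceDomain d) : MeasurableSet D.Γ := by
  rw [D.interface_eq]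
  exact D.isOpen.measurableSet.inter isClosed_frontier.measurableSet

theorem isOpen_diff (D : InterfaceDomain d) : IsOpen (D.Ω \ D.Γ) := by
  rw [D.bisected]
  exact D.isOpen₁.union D.isOpen₂

theorem volume_interface (D : InterfaceDomain d) : volume D.Γ = 0 :=
  measure_mono_null D.interface_subset₁ (volume_frontier_eq_zero D.isOpen₁ D.isLipschitz₁)

theorem vol_eq (D : InterfaceDomain d) : D.vol = volume.restrict (D.Ω \ D.Γ) :=
  Measure.restrict_congr_set (sdiff_null_ae_eq_self D.volume_interface).symm

theorem subset₁ (D : InterfaceDomain d) : D.Ω₁ ⊆ D.Ω := fun _ hx =>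
  (D.bisected.symm ▸ Or.inl hx : _ ∈ D.Ω \ D.Γ).1

theorem subset₂ (D : InterfaceDomain d) : D.Ω₂ ⊆ D.Ω := fun _ hx =>
  (D.bisected.symm ▸ Or.inr hx : _ ∈ D.Ω \ D.Γ).1

instance (D : InterfaceDomain d) : IsFiniteMeasure D.vol :=
  ⟨by
    rw [vol, Measure.restrict_apply_univ]
    exact D.isBounded.measure_lt_top⟩

/-! ### Uniqueness and linearity of gradients and jumps -/

variable {q q' : Vec d → Vec N} {w w' : Vec d → Mat d N} {s s' : Vec d → Vec N}

theorem HasGrad.unique (h : D.HasGrad q w) (h' : D.HasGrad q w') : w =ᵐ[D.vol] w' := by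
  rw [vol_eq]
  exact HasWeakGrad.unique D.isOpen_diff h h'

theorem HasGrad.integrable (h : D.HasGrad q w) : Integrable w D.vol := by
  rw [vol_eq]
  exact h.2.1

theorem HasJump.sub (h : D.HasJump q s) (h' : D.HasJump q' s') :
    D.HasJump (q - q') (s - s') := by
  obtain ⟨t₁, t₂, h₁, h₂, e⟩ := h
  obtain ⟨t₁', t₂', h₁', h₂', e'⟩ := h'
  refine ⟨t₁ - t₁', t₂ - t₂', h₁.sub h₁', h₂.sub h₂', ?_⟩
  filter_upwards [e, e'] with x hx hx'
  rw [Pi.sub_apply, Pi.sub_apply, Pi.sub_apply, hx, hx']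
  abel

theorem HasJump.const_smul (h : D.HasJump q s) (c : ℝ) : D.HasJump (c • q) (c • s) := by
  obtain ⟨t₁, t₂, h₁, h₂, e⟩ := h
  refine ⟨c • t₁, c • t₂, h₁.const_smul c, h₂.const_smul c, ?_⟩
  filter_upwards [e] with x hx
  rw [Pi.smul_apply, hx, smul_sub]
  rfl

theorem surf_le₁ (D : InterfaceDomain d) :
    D.surf ≤ (surfaceMeasure d).restrict (frontier D.Ω₁) :=
  Measure.restrict_mono_set _ D.interface_subset₁

theorem surf_le₂ (D : InterfaceDomain d) :
    D.surf ≤ (surfaceMeasure d).restrict (frontier D.Ω₂) :=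
  Measure.restrict_mono_set _ D.interface_subset₂

theorem HasJump.unique (h : D.HasJump q s) (h' : D.HasJump q s') : s =ᵐ[D.surf] s' := by
  obtain ⟨t₁, t₂, h₁, h₂, e⟩ := h
  obtain ⟨t₁', t₂', h₁', h₂', e'⟩ := h'
  filter_upwards [e, e', ae_mono D.surf_le₁ (h₁.unique D.isOpen₁ D.isLipschitz₁ h₁'),
    ae_mono D.surf_le₂ (h₂.unique D.isOpen₂ D.isLipschitz₂ h₂')] with x h1 h2 h3 h4
  rw [h1, h2, h3, h4]

theorem HasJump.aemeasurable (h : D.HasJump q s) : AEMeasurable s D.surf := by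
  obtain ⟨t₁, t₂, h₁, h₂, e⟩ := h
  have i₁ : Integrable t₁ D.surf := Integrable.mono_measure h₁.1 D.surf_le₁
  have i₂ : Integrable t₂ D.surf := Integrable.mono_measure h₂.1 D.surf_le₂
  exact (i₂.aemeasurable.sub i₁.aemeasurable).congr e.symm

/-- Sobolev functions on the whole of `Ω` do not jump: near a point of `Γ`, the divergence
theorems on the two sides of the interface add up to the definition of the weak gradient in `Ω`,
so that the traces from both sides have the same pairings. -/
theorem HasJump.eq_zero_of_hasWeakGrad (hq : HasWeakGrad D.Ω q w) (h : D.HasJump q s) :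
    s =ᵐ[D.surf] 0 := by
  obtain ⟨t₁, t₂, h₁, h₂, e⟩ := h
  have hnull : surfaceMeasure d ({y | t₁ y ≠ t₂ y} ∩ D.Γ) = 0 := by
    refine measure_null_of_locally_null _ fun x hx => ?_
    obtain ⟨e, γ, K, r, he, hγ, hr, hUr⟩ := D.isLipschitz₁ x (D.interface_subset₁ hx.2)
    have hB : IsOpen (Metric.ball x r ∩ D.Ω) := Metric.isOpen_ball.inter D.isOpen
    set B := Metric.ball x r ∩ D.Ω
    have hxB : x ∈ B := ⟨Metric.mem_ball_self hr, D.interface_subset hx.2⟩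
    refine ⟨_, inter_mem_nhdsWithin _ (hB.mem_nhds hxB), ?_⟩
    have hB₁ : ∀ y ∈ B, y ∈ D.Ω₁ ↔ γ (perp e y) < inner ℝ e y := fun y hy => hUr y hy.1
    have hfr : ∀ y ∈ B, y ∈ D.Γ ↔ γ (perp e y) = inner ℝ e y := fun y hy => by
      rw [← mem_frontier_iff_of_epigraph D.isOpen₁ he hγ.continuous hB hB₁ hy, D.interface_eq]
      exact ⟨fun h => h.2, fun h => ⟨hy.2, h⟩⟩
    have hB₂ : ∀ y ∈ B, y ∈ D.Ω₂ ↔ inner ℝ e y < γ (perp e y) := by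
      intro y hy
      constructor
      · intro h2
        have hΓ : y ∉ D.Γ := (D.bisected.symm ▸ Or.inr h2 : y ∈ D.Ω \ D.Γ).2
        have h1 : y ∉ D.Ω₁ := fun h1 => Set.disjoint_left.1 D.disjoint_pieces h1 h2
        rw [hB₁ y hy, not_lt] at h1
        rw [hfr y hy] at hΓ
        exact lt_of_le_of_ne h1 (Ne.symm hΓ)
      · intro hlt
        have hΓ : y ∉ D.Γ := fun h => hlt.ne ((hfr y hy).1 h).symm
        rcases D.bisected.subset (⟨hy.2, hΓ⟩ : y ∈ D.Ω \ D.Γ) with h | h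
        · exact absurd ((hB₁ y hy).1 h) hlt.not_gt
        · exact h
    have p₁ := isBoundaryPatch_of_epigraph D.isOpen₁ he hγ.continuous hB hB₁
    have p₂ := isBoundaryPatch_of_hypograph D.isOpen₂ he hγ.continuous hB hB₂
      fun y hy h => D.interface_subset₂ ((hfr y hy).2 h)
    refine surfaceMeasure_ne_eq_zero hB he hγ (h₁.integrable_of_le p₁.le)
      (h₂.integrable_of_le p₂.le) (fun ψ hψ hψc hψB c => ?_) fun y hy =>
        ⟨hy.2, (hfr y hy.2).1 hy.1.2, hy.1.1⟩
    have e₁ := h₁.integral_patch D.isOpen₁ (hq.mono D.subset₁) p₁ hψ hψc hψB c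
    have e₂ := h₂.integral_patch D.isOpen₂ (hq.mono D.subset₂) p₂ hψ hψc hψB c
    have f1 : ContDiff ℝ ∞ fun y => ψ y • tensor e c := hψ.smul contDiff_const
    have f1c : HasCompactSupport fun y => ψ y • tensor e c := hψc.smul_right
    have f2 : Continuous fun y => fderiv ℝ ψ y e • c :=
      ((hψ.continuous_fderiv (by simp)).clm_apply continuous_const).smul continuous_const
    have f2c : HasCompactSupport fun y => fderiv ℝ ψ y e • c :=
      (hψc.fderiv_apply (𝕜 := ℝ) e).smul_right
    have e₀ := hq.2.2 _ f1 f1c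
      ((tsupport_smul_subset_left _ _).trans (hψB.trans inter_subset_right))
    simp only [divMat_smul_tensor hψ] at e₀
    have split : ∀ F : Vec d → ℝ, IntegrableOn F D.Ω →
        ∫ y in D.Ω, F y = (∫ y in D.Ω₁, F y) + ∫ y in D.Ω₂, F y := fun F hF => by
      rw [← setIntegral_union D.disjoint_pieces D.isOpen₂.measurableSet
        (hF.mono_set D.subset₁) (hF.mono_set D.subset₂), ← D.bisected]
      exact congrArg (fun μ => ∫ y, F y ∂μ) D.vol_eq
    rw [split _ (integrable_inner_of_hasCompactSupport hq.2.1 f1.continuous f1c),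
      split _ (integrable_inner_of_hasCompactSupport hq.1 f2 f2c)] at e₀
    linarith
  rw [surf]
  have key : ∀ᵐ y ∂(surfaceMeasure d).restrict D.Γ, t₁ y = t₂ y := by
    rw [ae_restrict_iff' D.measurableSet_interface]
    refine measure_mono_null (fun y hy => ?_) hnull
    simp only [mem_compl_iff, mem_ofPred_eq, Classical.not_imp] at hy
    exact ⟨hy.2, hy.1⟩
  filter_upwards [key, e] with y h1 h2
  rw [h2, h1, sub_self, Pi.zero_apply]

theorem VanishesOnΓD.const_smul (h : D.VanishesOnΓD q) (c : ℝ) : D.VanishesOnΓD (c • q) := by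
  obtain ⟨⟨t₁, h₁, e₁⟩, ⟨t₂, h₂, e₂⟩⟩ := h
  refine ⟨⟨c • t₁, h₁.const_smul c, e₁.mono fun x hx => ?_⟩,
    ⟨c • t₂, h₂.const_smul c, e₂.mono fun x hx => ?_⟩⟩
  · rw [Pi.smul_apply, hx, smul_zero]
  · rw [Pi.smul_apply, hx, smul_zero]

/-! ### Uniqueness and linearity of normal fluxes -/

variable {τ τ' : Vec d → Mat d N} {β β' : Vec d → Vec N}

theorem integrableOn_inner_gradMat {φ : Vec d → Vec N} (hφ : D.IsTestFun φ)
    (hτ : IntegrableOn τ D.Ω₁) :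
    IntegrableOn (fun x => (inner ℝ (gradMat φ x) (τ x) : ℝ)) D.Ω₁ := by
  obtain ⟨⟨K, hK⟩, -, -⟩ := hφ
  have hm : Measurable (gradMat φ) :=
    gradLin.continuous.measurable.comp (measurable_fderiv ℝ φ)
  have hb : ∀ x, ‖gradMat φ x‖ ≤ ‖gradLin (d := d) (N := N)‖ * K := fun x =>
    (gradLin.le_opNorm _).trans (by gcongr; exact norm_fderiv_le_of_lipschitz ℝ hK)
  refine (integrable_inner_of_bound hτ hm.aestronglyMeasurable hb).congr
    (Eventually.of_forall fun x => ?_)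
  exact real_inner_comm _ _

theorem IsTestFun.integrable_inner {φ : Vec d → Vec N} (hφ : D.IsTestFun φ)
    (hβ : Integrable β D.surf) : Integrable (fun x => (inner ℝ (β x) (φ x) : ℝ)) D.surf :=
  integrable_inner_of_hasCompactSupport hβ hφ.1.choose_spec.continuous hφ.2.1

theorem HasNormalFlux.sub (h : D.HasNormalFlux τ β) (h' : D.HasNormalFlux τ' β') :
    D.HasNormalFlux (τ - τ') (β - β') := by
  refine ⟨h.1.sub h'.1, h.2.1.sub h'.2.1, fun φ hφ => ?_⟩
  simp only [Pi.sub_apply, inner_sub_left, inner_sub_right]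
  rw [integral_sub (hφ.integrable_inner h.2.1) (hφ.integrable_inner h'.2.1),
    integral_sub (integrableOn_inner_gradMat hφ h.1) (integrableOn_inner_gradMat hφ h'.1),
    h.2.2 φ hφ, h'.2.2 φ hφ]

theorem HasNormalFlux.const_smul (h : D.HasNormalFlux τ β) (c : ℝ) :
    D.HasNormalFlux (c • τ) (c • β) := by
  refine ⟨h.1.smul c, h.2.1.smul c, fun φ hφ => ?_⟩
  simp only [Pi.smul_apply, real_inner_smul_left, real_inner_smul_right, integral_const_mul]
  rw [h.2.2 φ hφ]

theorem HasNormalFlux.zero : D.HasNormalFlux (0 : Vec d → Mat d N) 0 :=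
  ⟨integrable_zero _ _ _, integrable_zero _ _ _, fun φ _ => by simp⟩

theorem HasNormalFlux.unique (h : D.HasNormalFlux τ β) (h' : D.HasNormalFlux τ β') :
    β =ᵐ[D.surf] β' := by
  have key := ae_eq_zero_of_forall_integral_inner D.isOpen (h.2.1.sub h'.2.1)
    fun g hg hgc hgΩ c => by
      have hs : HasCompactSupport fun y => g y • c := hgc.smul_right
      have ht : D.IsTestFun fun y => g y • c :=
        ⟨ContDiff.lipschitzWith_of_hasCompactSupport (𝕂 := ℝ) hs (hg.smul contDiff_const)
          (by simp), hs, (tsupport_smul_subset_left _ _).trans hgΩ⟩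
      simp only [Pi.sub_apply, inner_sub_left]
      rw [integral_sub (ht.integrable_inner h.2.1) (ht.integrable_inner h'.2.1), h.2.2 _ ht,
        h'.2.2 _ ht, sub_self]
  filter_upwards [key, ae_restrict_mem D.measurableSet_interface] with x hx hxΓ
  exact sub_eq_zero.1 (hx (D.interface_subset hxΓ))

/-! ### The test spaces are closed under scalar multiplication -/

variable {Φ : Vec d → Mat d N → ℝ} {Ψ : Vec d → Vec N → ℝ}

theorem NFunctionPair.isYoungPair_Φ (h : D.NFunctionPair Φ Ψ) (hN : 1 ≤ N) :
    IsYoungPair D.vol Φ (conj Φ) := by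
  have : Nonempty (Fin d × Fin N) := ⟨(⟨0, by have := D.two_le; omega⟩, ⟨0, hN⟩)⟩
  exact h.nfun_Φ.isYoungPair h.int_Φ h.int_Φ'

theorem NFunctionPair.isYoungPair_Ψ (h : D.NFunctionPair Φ Ψ) (hN : 1 ≤ N) :
    IsYoungPair D.surf Ψ (conj Ψ) := by
  have : Nonempty (Fin N) := ⟨⟨0, hN⟩⟩
  exact h.nfun_Ψ.isYoungPair h.int_Ψ h.int_Ψ'

theorem NFunctionPair.isFiniteMeasure_surf (h : D.NFunctionPair Φ Ψ) (hN : 1 ≤ N) :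
    IsFiniteMeasure D.surf := by
  have : Nonempty (Fin N) := ⟨⟨0, hN⟩⟩
  exact (h.isYoungPair_Ψ hN).isFiniteMeasure

theorem memEP_zero (hp : IsYoungPair D.vol Φ (conj Φ)) (hp' : IsYoungPair D.surf Ψ (conj Ψ)) :
    D.MemEP Φ Ψ 0 0 0 where
  memP :=
    { grad := HasWeakGrad.zero
      grad_mem := Submodule.zero_mem _
      jump := ⟨0, 0, HasTrace.zero, HasTrace.zero, Eventually.of_forall fun x => by simp⟩
      jump_mem := Submodule.zero_mem _
      vanishes := ⟨⟨0, HasTrace.zero, Eventually.of_forall fun _ => rfl⟩,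
        ⟨0, HasTrace.zero, Eventually.of_forall fun _ => rfl⟩⟩ }
  grad_memE := hp.left.zero_mem_orliczE
  jump_memE := hp'.left.zero_mem_orliczE

theorem MemEP.const_smul (hp : IsYoungPair D.vol Φ (conj Φ))
    (hp' : IsYoungPair D.surf Ψ (conj Ψ)) (h : D.MemEP Φ Ψ q w s) (c : ℝ) :
    D.MemEP Φ Ψ (c • q) (c • w) (c • s) where
  memP :=
    { grad := HasWeakGrad.const_smul h.memP.grad c
      grad_mem := Submodule.smul_mem _ c h.memP.grad_mem
      jump := h.memP.jump.const_smul c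
      jump_mem := Submodule.smul_mem _ c h.memP.jump_mem
      vanishes := h.memP.vanishes.const_smul c }
  grad_memE := hp.left.smul_mem_orliczE h.grad_memE c
  jump_memE := hp'.left.smul_mem_orliczE h.jump_memE c

theorem memEX_zero (hp : IsYoungPair D.vol Φ (conj Φ)) (hp' : IsYoungPair D.surf Ψ (conj Ψ)) :
    D.MemEX Φ Ψ 0 0 where
  memX :=
    { mem := Submodule.zero_mem _
      flux := HasNormalFlux.zero
      flux_mem := Submodule.zero_mem _
      orthogonal := fun q w s _ => by simp }
  memE := hp.right.zero_mem_orliczE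
  flux_memE := hp'.right.zero_mem_orliczE

theorem MemEX.const_smul (hp : IsYoungPair D.vol Φ (conj Φ))
    (hp' : IsYoungPair D.surf Ψ (conj Ψ)) (h : D.MemEX Φ Ψ τ β) (c : ℝ) :
    D.MemEX Φ Ψ (c • τ) (c • β) where
  memX :=
    { mem := Submodule.smul_mem _ c h.memX.mem
      flux := h.memX.flux.const_smul c
      flux_mem := Submodule.smul_mem _ c h.memX.flux_mem
      orthogonal := fun q w s hq => by
        simp only [Pi.smul_apply, real_inner_smul_left, real_inner_smul_right,
          integral_const_mul]
        rw [← mul_add, h.memX.orthogonal q w s hq, mul_zero] }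
  memE := hp.right.smul_mem_orliczE h.memE c
  flux_memE := hp'.right.smul_mem_orliczE h.flux_memE c

/-! ### The primal problem and the flux problem -/

theorem lintegral_add_lt_top {X : Type*} [MeasurableSpace X] {μ : Measure X} {f g : X → ℝ}
    (hf : Integrable f μ) (hg : Integrable g μ) :
    ∫⁻ x, ENNReal.ofReal (f x + g x) ∂μ < ⊤ :=
  (lintegral_ofReal_le_lintegral_enorm _).trans_lt (hf.add hg).2

variable {φ₀ φ : Vec d → Vec N} {j₀ j : Vec d → Mat d N}

theorem IsVariationalWeakSolution.isWeakSolution (hN : 1 ≤ N) (hΦΨ : D.NFunctionPair Φ Ψ)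
    (hφ₀ : D.DirichletData Φ φ₀) (hj₀ : D.NeumannData Φ j₀)
    {h : Vec d → Mat d N → Mat d N} {b : Vec d → Vec N → Vec N}
    (hyp : D.PrimalAssumptions Φ Ψ h b) (hφ : D.IsVariationalWeakSolution Φ Ψ h b φ₀ j₀ φ) :
    D.IsWeakSolution Φ Ψ h b φ₀ j₀ φ ∧
      ∀ (w : Vec d → Mat d N) (s : Vec d → Vec N), D.HasGrad φ w → D.HasJump φ s →
        (∫⁻ x, ENNReal.ofReal (Φ x (w x) + conj Φ x (h x (w x))) ∂D.vol) +
          ∫⁻ x, ENNReal.ofReal (Ψ x (s x) + conj Ψ x (b x (s x))) ∂D.surf < ⊤ := by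
  have hp := hΦΨ.isYoungPair_Φ hN
  have hp' := hΦΨ.isYoungPair_Ψ hN
  have := hΦΨ.isFiniteMeasure_surf hN
  obtain ⟨hP, w, w₀, s, hw, hw₀, hs, hvar⟩ := hφ
  obtain ⟨w₁, hw₁, hw₁E⟩ := hφ₀
  have hw₀E : w₀ ∈ orliczE D.vol Φ :=
    hp.left.orliczE_congr (HasGrad.unique (hw₁.mono sdiff_subset) hw₀) hw₁E
  obtain ⟨⟨i1, i2⟩, ⟨i3, i4⟩, heq⟩ := weak_of_variational hp hp' hyp.mono_h.caratheodory
    hyp.mono_b.caratheodory hyp.coercive_h hyp.coercive_b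
    (T := {p | ∃ q, D.MemEP Φ Ψ q p.1 p.2}) ⟨0, memEP_zero hp hp'⟩
    (fun c p ⟨q, hq⟩ => ⟨c • q, hq.const_smul hp hp' c⟩)
    (fun p ⟨q, hq⟩ => ⟨hq.grad_memE, hq.jump_memE⟩) hw.integrable.aemeasurable hw₀E hj₀.1
    hs.aemeasurable (fun p ⟨q, hq⟩ => hvar q p.1 p.2 hq)
  refine ⟨⟨hP, w, s, hw, hs, ?_, ?_, fun q wq sq hq => heq (wq, sq) ⟨q, hq⟩⟩,
    fun w' s' hw' hs' => ?_⟩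
  · exact hp.symm.mem_orliczL_of_modular
      (hyp.mono_h.caratheodory.aemeasurable_comp hw.integrable.aemeasurable) i2
  · exact hp'.symm.mem_orliczL_of_modular
      (hyp.mono_b.caratheodory.aemeasurable_comp hs.aemeasurable) i4
  · have hww := hw'.unique hw
    have hss := hs'.unique hs
    refine ENNReal.add_lt_top.2 ⟨?_, ?_⟩
    · exact lintegral_add_lt_top (i1.congr (hww.mono fun x hx => by simp only [hx]))
        (i2.congr (hww.mono fun x hx => by simp only [hx]))
    · exact lintegral_add_lt_top (i3.congr (hss.mono fun x hx => by simp only [hx]))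
        (i4.congr (hss.mono fun x hx => by simp only [hx]))

theorem IsWeakSolution.isVariationalWeakSolution (hN : 1 ≤ N) (hΦΨ : D.NFunctionPair Φ Ψ)
    (hφ₀ : D.DirichletData Φ φ₀) (hj₀ : D.NeumannData Φ j₀)
    {h : Vec d → Mat d N → Mat d N} {b : Vec d → Vec N → Vec N} (hΔ : D.DeltaCondition Φ Ψ)
    (hBP : ∃ w s, D.MemBP Φ Ψ (φ - φ₀) w s) (hφ : D.IsWeakSolution Φ Ψ h b φ₀ j₀ φ) :
    D.IsVariationalWeakSolution Φ Ψ h b φ₀ j₀ φ := by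
  have hp := hΦΨ.isYoungPair_Φ hN
  have hp' := hΦΨ.isYoungPair_Ψ hN
  obtain ⟨hP, w, s, hw, hs, hH, hH', heq⟩ := hφ
  obtain ⟨w', s', hP', qn, wn, sn, hn, hlim, hlim'⟩ := hBP
  obtain ⟨w₀, hw₀, hw₀E⟩ := hφ₀
  have hw₀' : D.HasGrad φ₀ w₀ := hw₀.mono sdiff_subset
  have hww : w - w₀ =ᵐ[D.vol] w' := HasGrad.unique (HasWeakGrad.sub hw hw₀') hP'.grad
  have hss : s =ᵐ[D.surf] s' := by
    have hjump := hs.sub hP'.jump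
    rw [sub_sub_cancel] at hjump
    filter_upwards [hjump.eq_zero_of_hasWeakGrad hw₀] with x hx
    exact sub_eq_zero.1 hx
  refine ⟨hP, w, w₀, s, hw, hw₀', hs, fun q wq sq hq => ?_⟩
  have key := variational_of_weak hp hp' hΔ (T := {p | ∃ q, D.MemEP Φ Ψ q p.1 p.2})
    (fun p ⟨q, hq⟩ => ⟨hq.grad_memE, hq.jump_memE⟩) hP'.grad_mem hP'.jump_mem hH hH' hj₀.1
    (fun h1 h2 => ⟨φ - φ₀, hP', h1, h2⟩) (p := fun n => (wn n, sn n)) (fun n => ⟨qn n, hn n⟩)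
    hlim hlim' (fun p ⟨q, hq⟩ => heq q p.1 p.2 hq) (wq, sq) ⟨q, hq⟩
  refine le_of_eq_of_le (congrArg₂ _ (extIntegral_congr_ae ?_) (extIntegral_congr_ae ?_)) key
  · filter_upwards [hww] with x hx
    rw [← hx, Pi.sub_apply]
  · filter_upwards [hss] with x hx
    rw [← hx]

theorem IsDualCoercive.isPairCoercive {X V : Type*} [MeasurableSpace X] [NormedAddCommGroup V]
    [InnerProductSpace ℝ V] [MeasurableSpace V] {μ : Measure X} {Υ : X → V → ℝ} {a : X → V → V}
    (h : IsDualCoercive μ Υ a) : IsPairCoercive μ (conj Υ) Υ a := by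
  obtain ⟨C, α, hC, hα, hα1, h⟩ := h
  refine ⟨C, α, hC, hα, hα1, h.mono fun x hx v => ?_⟩
  rw [add_comm (Υ x _)]
  exact hx v

theorem IsVariationalWeakFlux.isWeakFlux (hN : 1 ≤ N) (hΦΨ : D.NFunctionPair Φ Ψ)
    (hφ₀ : D.DirichletData Φ φ₀) (hj₀ : D.NeumannData Φ j₀)
    {f : Vec d → Mat d N → Mat d N} {g : Vec d → Vec N → Vec N}
    (hyp : D.DualAssumptions Φ Ψ f g) (hj : D.IsVariationalWeakFlux Φ Ψ f g φ₀ j₀ j) :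
    D.IsWeakFlux Φ Ψ f g φ₀ j₀ j ∧
      ∀ β : Vec d → Vec N, D.HasNormalFlux j β →
        (∫⁻ x, ENNReal.ofReal (Φ x (f x (j x)) + conj Φ x (j x)) ∂D.vol) +
          ∫⁻ x, ENNReal.ofReal (Ψ x (g x (β x)) + conj Ψ x (β x)) ∂D.surf < ⊤ := by
  have hp := hΦΨ.isYoungPair_Φ hN
  have hp' := hΦΨ.isYoungPair_Ψ hN
  have := hΦΨ.isFiniteMeasure_surf hN
  obtain ⟨⟨β₁, hX⟩, w₀, β, hw₀, hβ, hvar⟩ := hj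
  obtain ⟨w₁, hw₁, hw₁E⟩ := hφ₀
  have hw₀E : w₀ ∈ orliczE D.vol Φ :=
    hp.left.orliczE_congr (HasGrad.unique (hw₁.mono sdiff_subset) hw₀) hw₁E
  have hjm : AEMeasurable j D.vol := by
    have hL : j ∈ orliczL D.vol (conj Φ) := by
      have := Submodule.add_mem _ hX.mem hj₀.1.1
      rwa [sub_add_cancel] at this
    exact (hp.right.mem_orliczL_iff.1 hL).1.aemeasurable
  obtain ⟨⟨i1, i2⟩, ⟨i3, i4⟩, heq⟩ := weak_of_variational hp.symm hp'.symm
    hyp.mono_f.caratheodory hyp.mono_g.caratheodory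
    (IsDualCoercive.isPairCoercive hyp.coercive_f) (IsDualCoercive.isPairCoercive hyp.coercive_g)
    (T := {p | D.MemEX Φ Ψ p.1 p.2}) (memEX_zero hp hp')
    (fun c p hq => hq.const_smul hp hp' c) (fun p hq => ⟨hq.memE, hq.flux_memE⟩) hjm hj₀.1 hw₀E
    hβ.2.1.aemeasurable (fun p hq => hvar p.1 p.2 hq)
  refine ⟨⟨⟨β₁, hX⟩, w₀, β, hw₀, hβ, ?_, ?_, fun τ βτ hτ => heq (τ, βτ) hτ⟩, fun β' hβ' => ?_⟩
  · exact hp.mem_orliczL_of_modular (hyp.mono_f.caratheodory.aemeasurable_comp hjm) i2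
  · exact hp'.mem_orliczL_of_modular
      (hyp.mono_g.caratheodory.aemeasurable_comp hβ.2.1.aemeasurable) i4
  · have hββ := hβ'.unique hβ
    refine ENNReal.add_lt_top.2 ⟨lintegral_add_lt_top i2 i1, ?_⟩
    exact lintegral_add_lt_top (i4.congr (hββ.mono fun x hx => by simp only [hx]))
      (i3.congr (hββ.mono fun x hx => by simp only [hx]))

theorem IsWeakFlux.isVariationalWeakFlux (hN : 1 ≤ N) (hΦΨ : D.NFunctionPair Φ Ψ)
    (hφ₀ : D.DirichletData Φ φ₀) (hj₀ : D.NeumannData Φ j₀)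
    {f : Vec d → Mat d N → Mat d N} {g : Vec d → Vec N → Vec N} (hΔ : D.DeltaCondition Φ Ψ)
    (hBX : ∃ β, D.MemBX Φ Ψ (j - j₀) β) (hj : D.IsWeakFlux Φ Ψ f g φ₀ j₀ j) :
    D.IsVariationalWeakFlux Φ Ψ f g φ₀ j₀ j := by
  have hp := hΦΨ.isYoungPair_Φ hN
  have hp' := hΦΨ.isYoungPair_Ψ hN
  obtain ⟨hX, w₀, β, hw₀, hβ, hH, hH', heq⟩ := hj
  obtain ⟨β', hX', τn, βn, hn, hlim, hlim'⟩ := hBX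
  obtain ⟨w₁, hw₁, hw₁E⟩ := hφ₀
  have hw₀E : w₀ ∈ orliczE D.vol Φ :=
    hp.left.orliczE_congr (HasGrad.unique (hw₁.mono sdiff_subset) hw₀) hw₁E
  have hββ : β =ᵐ[D.surf] β' := by
    have := (hβ.sub hj₀.2.1).unique hX'.flux
    rwa [sub_zero] at this
  refine ⟨hX, w₀, β, hw₀, hβ, fun τ βτ hτ => ?_⟩
  have key := variational_of_weak hp.symm hp'.symm hΔ.symm (T := {p | D.MemEX Φ Ψ p.1 p.2})
    (fun p hq => ⟨hq.memE, hq.flux_memE⟩) hX'.mem hX'.flux_mem hH hH' hw₀E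
    (fun h1 h2 => ⟨hX', h1, h2⟩) (p := fun n => (τn n, βn n)) hn
    hlim hlim' (fun p hq => heq p.1 p.2 hq) (τ, βτ) hτ
  refine le_of_eq_of_le (congrArg₂ _ rfl (extIntegral_congr_ae ?_)) key
  filter_upwards [hββ] with x hx
  rw [← hx]

end InterfaceDomain

end InterfaceProblem

theorem mainTheorem4 {d N : ℕ} (hN : 1 ≤ N) (D : InterfaceDomain d)
    (Φ : Vec d → Mat d N → ℝ) (Ψ : Vec d → Vec N → ℝ) (hΦΨ : D.NFunctionPair Φ Ψ)
    (φ₀ : Vec d → Vec N) (j₀ : Vec d → Mat d N)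
    (hφ₀ : D.DirichletData Φ φ₀) (hj₀ : D.NeumannData Φ j₀) :
    (∀ (h : Vec d → Mat d N → Mat d N) (b : Vec d → Vec N → Vec N),
      D.PrimalAssumptions Φ Ψ h b →
      (∀ φ : Vec d → Vec N, D.IsVariationalWeakSolution Φ Ψ h b φ₀ j₀ φ →
        D.IsWeakSolution Φ Ψ h b φ₀ j₀ φ ∧
        ∀ (w : Vec d → Mat d N) (s : Vec d → Vec N), D.HasGrad φ w → D.HasJump φ s →
          (∫⁻ x, ENNReal.ofReal (Φ x (w x) + conj Φ x (h x (w x))) ∂D.vol) +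
            ∫⁻ x, ENNReal.ofReal (Ψ x (s x) + conj Ψ x (b x (s x))) ∂D.surf < ⊤) ∧
      (D.DeltaCondition Φ Ψ → ∀ φ : Vec d → Vec N,
        (∃ w s, D.MemBP Φ Ψ (φ - φ₀) w s) → D.IsWeakSolution Φ Ψ h b φ₀ j₀ φ →
        D.IsVariationalWeakSolution Φ Ψ h b φ₀ j₀ φ)) ∧
    (∀ (f : Vec d → Mat d N → Mat d N) (g : Vec d → Vec N → Vec N),
      D.DualAssumptions Φ Ψ f g →
      (∀ j : Vec d → Mat d N, D.IsVariationalWeakFlux Φ Ψ f g φ₀ j₀ j →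
        D.IsWeakFlux Φ Ψ f g φ₀ j₀ j ∧
        ∀ β : Vec d → Vec N, D.HasNormalFlux j β →
          (∫⁻ x, ENNReal.ofReal (Φ x (f x (j x)) + conj Φ x (j x)) ∂D.vol) +
            ∫⁻ x, ENNReal.ofReal (Ψ x (g x (β x)) + conj Ψ x (β x)) ∂D.surf < ⊤) ∧
      (D.DeltaCondition Φ Ψ → ∀ j : Vec d → Mat d N,
        (∃ β, D.MemBX Φ Ψ (j - j₀) β) → D.IsWeakFlux Φ Ψ f g φ₀ j₀ j →
        D.IsVariationalWeakFlux Φ Ψ f g φ₀ j₀ j)) :=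
  ⟨fun _ _ hyp =>
    ⟨fun _ hφ => hφ.isWeakSolution hN hΦΨ hφ₀ hj₀ hyp,
      fun hΔ _ hBP hφ => hφ.isVariationalWeakSolution hN hΦΨ hφ₀ hj₀ hΔ hBP⟩,
    fun _ _ hyp =>
    ⟨fun _ hj => hj.isWeakFlux hN hΦΨ hφ₀ hj₀ hyp,
      fun hΔ _ hBX hj => hj.isVariationalWeakFlux hN hΦΨ hφ₀ hj₀ hΔ hBX⟩⟩
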